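/- Let $\mathcal K$ be an essentially small rigid tensor-triangulated category: a triangulated category with a symmetric monoidal tensor product that is exact in each variable and for which every object has a dual. Let $\mathrm{Spc}(\mathcal K)$ be its triangular spectrum, i.e. the set of prime (proper) thick $\otimes$-ideals $\mathcal P\subsetneq\mathcal K$, with the topology for which the supports $\mathrm{supp}(x)=\{\mathcal P\mid x\notin\mathcal P\}$, $x\in\mathcal K$, form a basis of closed subsets. Let $\mathrm{Mod}\text{-}\mathcal K$ be the category of additive functors $\mathcal K^{\mathrm{op}}\to\mathrm{Ab}$ with the Day convolution tensor product, $\mathrm h:\mathcal K\to\mathrm{Mod}\text{-}\mathcal K$, $x\mapsto\mathrm{Hom}_{\mathcal K}(-,x)$, the Yoneda embedding, and $\mathrm{mod}\text{-}\mathcal K\subset\mathrm{Mod}\text{-}\mathcal K$ the abelian tensor subcategory of finitely presented objects. A homological prime is a maximal proper Serre $\otimes$-ideal $\mathcal B\subset\mathrm{mod}\text{-}\mathcal K$; its homological residue field is the composite $$\bar h_{\mathcal B}:\ \mathcal K\xrightarrow{\ \mathrm h\ }\mathrm{Mod}\text{-}\mathcal K\longrightarrow(\mathrm{Mod}\text{-}\mathcal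 K)/\langle\mathcal B\rangle$$ of the Yoneda embedding with the Gabriel quotient by the localizing subcategory $\langle\mathcal B\rangle$ generated by $\mathcal B$. One says that $\mathcal B$ lives over $W\subseteq\mathrm{Spc}(\mathcal K)$ if the triangular prime $\mathrm h^{-1}(\mathcal B)$ belongs to $W$. Let $f:x\to y$ be a morphism in $\mathcal K$ and let $W\subseteq\mathrm{Spc}(\mathcal K)$ be a closed subset such that $\bar h_{\mathcal B}(f)=0$ for every homological prime $\mathcal B$ living over $W$. Then there exists a Thomason closed subset $Z\supseteq W$ of $\mathrm{Spc}(\mathcal K)$ (i.e. a closed subset with quasi-compact open complement) such that for every $z\in\mathcal K$ with $\mathrm{supp}(z)\subseteq Z$ there exists $n\ge 1$ with $f^{\otimes n}\otimes z=0$ in $\mathcal K$. In particular, there is some $z\in\mathcal K$ with $\mathrm{supp}(z)=Z\supseteq W$ and some $n\ge1$ such that $f^{\otimes n}\otimes z=0$. -/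

import Mathlib

open CategoryTheory Limits MonoidalCategory Opposite
open scoped ZeroObject
universe v u
namespace TTGeom
noncomputable section

section Modules
variable {K : Type u} [Category.{v} K] [Preadditive K]

instance additive_closedUnderLimits {J : Type*} [Category* J] [HasLimitsOfShape J AddCommGrpCat.{v}] :
    (additiveFunctor Kᵒᵖ AddCommGrpCat.{v}).IsClosedUnderLimitsOfShape J where
  limitsOfShape_le := by
    rintro F ⟨h⟩
    have hprop := h.prop_diag_obj
    refine ⟨fun {X Y f g} => ?_⟩
    refine (isLimitOfPreserves ((evaluation Kᵒᵖ AddCommGrpCat.{v}).obj Y) h.isLimit).hom_ext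
      fun j => ?_
    have : (h.diag.obj j).Additive := hprop j
    have e : ∀ k : X ⟶ Y, F.map k ≫ (h.π.app j).app Y = (h.π.app j).app X ≫ (h.diag.obj j).map k :=
      fun k => (h.π.app j).naturality k
    change F.map (f + g) ≫ (h.π.app j).app Y = (F.map f + F.map g) ≫ (h.π.app j).app Y
    rw [Preadditive.add_comp, e, e, e, Functor.map_add, Preadditive.comp_add]

instance additive_closedUnderColimits {J : Type*} [Category* J] [HasColimitsOfShape J AddCommGrpCat.{v}] :
    (additiveFunctor Kᵒᵖ AddCommGrpCat.{v}).IsClosedUnderColimitsOfShape J where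
  colimitsOfShape_le := by
    rintro F ⟨h⟩
    have hprop := h.prop_diag_obj
    refine ⟨fun {X Y f g} => ?_⟩
    refine (isColimitOfPreserves ((evaluation Kᵒᵖ AddCommGrpCat.{v}).obj X) h.isColimit).hom_ext
      fun j => ?_
    have : (h.diag.obj j).Additive := hprop j
    have e : ∀ k : X ⟶ Y, (h.ι.app j).app X ≫ F.map k = (h.diag.obj j).map k ≫ (h.ι.app j).app Y :=
      fun k => ((h.ι.app j).naturality k).symm
    change (h.ι.app j).app X ≫ F.map (f + g) = (h.ι.app j).app X ≫ (F.map f + F.map g)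
    rw [Preadditive.comp_add, e, e, e, Functor.map_add, Preadditive.add_comp]

instance : (additiveFunctor Kᵒᵖ AddCommGrpCat.{v}).IsClosedUnderKernels where
  kernels_le := by
    rintro _ ⟨f, k, hk, hf⟩
    exact ObjectProperty.prop_of_isLimit _ hk (by rintro (_ | _); exacts [hf.1, hf.2])

instance : (additiveFunctor Kᵒᵖ AddCommGrpCat.{v}).IsClosedUnderCokernels where
  cokernels_le := by
    rintro _ ⟨f, k, hk, hf⟩
    exact ObjectProperty.prop_of_isColimit _ hk (by rintro (_ | _); exacts [hf.1, hf.2])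

instance : (additiveFunctor Kᵒᵖ AddCommGrpCat.{v}).IsClosedUnderFiniteProducts where

instance : (additiveFunctor Kᵒᵖ AddCommGrpCat.{v}).ContainsZero where
  exists_zero := by
    obtain ⟨Z, hZ⟩ := HasZeroObject.zero (C := Kᵒᵖ ⥤ AddCommGrpCat.{v})
    exact ⟨Z, hZ, ⟨fun {X Y f g} => (hZ.obj X).eq_of_src _ _⟩⟩

variable (K) in
/-- `Mod-K`: the category of right `K`-modules, i.e. of additive functors `Kᵒᵖ ⥤ Ab`. -/
abbrev ModCat := Kᵒᵖ ⥤+ AddCommGrpCat.{v}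

instance : Abelian (ModCat K) := inferInstance

variable (K) in
/-- The Yoneda embedding `h : K ⥤ Mod-K`, `x ↦ x̂ = Hom_K(-, x)`. -/
def yo : K ⥤ ModCat K :=
  ObjectProperty.lift _ preadditiveYoneda (fun X => additive_yonedaObj' X)

instance : (yo K).Additive where
  map_add {X Y f g} := by
    apply ObjectProperty.hom_ext
    ext Z t
    exact Preadditive.comp_add _ _ _ t f g

lemma map_zero_apply (M : ModCat K) {x y : K} (m : M.obj.obj (op x)) :
    M.obj.map (0 : y ⟶ x).op m = 0 := by
  rw [op_zero, CategoryTheory.Functor.map_zero]; rfl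

lemma map_add_apply (M : ModCat K) {x y : K} (f g : y ⟶ x) (m : M.obj.obj (op x)) :
    M.obj.map (f + g).op m = M.obj.map f.op m + M.obj.map g.op m := by
  rw [op_add, CategoryTheory.Functor.map_add]; rfl

lemma map_comp_apply (M : ModCat K) {x y z : K} (f : z ⟶ y) (g : y ⟶ x) (m : M.obj.obj (op x)) :
    M.obj.map (f ≫ g).op m = M.obj.map f.op (M.obj.map g.op m) := by
  rw [op_comp, CategoryTheory.Functor.map_comp]; rfl

lemma map_id_apply (M : ModCat K) {x : K} (m : M.obj.obj (op x)) :
    M.obj.map (𝟙 x).op m = m := by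
  rw [op_id, CategoryTheory.Functor.map_id]; rfl

/-- The morphism `x̂ ⟶ M` classified by an element of `M(x)`. -/
def yoHom {x : K} {M : ModCat K} (m : M.obj.obj (op x)) : (yo K).obj x ⟶ M :=
  ObjectProperty.homMk
    { app := fun z => AddCommGrpCat.ofHom
        { toFun := fun t : z.unop ⟶ x => M.obj.map t.op m
          map_zero' := map_zero_apply M m
          map_add' := fun s t => map_add_apply M s t m }
      naturality := fun z w g => by
        ext t
        exact map_comp_apply M g.unop t m }

/-- The element of `M(x)` that corresponds to a morphism `x̂ ⟶ M`. -/
def yoElt {x : K} {M : ModCat K} (t : (yo K).obj x ⟶ M) : M.obj.obj (op x) :=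
  t.hom.app (op x) (𝟙 x)

lemma yoElt_yoHom {x : K} {M : ModCat K} (m : M.obj.obj (op x)) : yoElt (yoHom m) = m := by
  exact map_id_apply M m

lemma app_eq {x z : K} {M : ModCat K} (t : (yo K).obj x ⟶ M) (g : z ⟶ x) :
    t.hom.app (op z) g = M.obj.map g.op (yoElt t) := by
  have := congr($(t.hom.naturality g.op) (𝟙 x))
  refine Eq.trans ?_ this
  change t.hom.app (op z) g = t.hom.app (op z) (g ≫ 𝟙 x)
  rw [Category.comp_id]

lemma yoElt_injective {x : K} {M : ModCat K} {s t : (yo K).obj x ⟶ M} (h : yoElt s = yoElt t) :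
    s = t := by
  apply ObjectProperty.hom_ext
  ext z g
  obtain ⟨z⟩ := z
  exact (app_eq s g).trans ((congr_arg _ h).trans (app_eq t g).symm)

lemma yoElt_comp {x : K} {M N : ModCat K} (t : (yo K).obj x ⟶ M) (f : M ⟶ N) :
    yoElt (t ≫ f) = f.hom.app (op x) (yoElt t) := rfl

lemma yoElt_map_comp {x z : K} {M : ModCat K} (g : z ⟶ x) (t : (yo K).obj x ⟶ M) :
    yoElt ((yo K).map g ≫ t) = M.obj.map g.op (yoElt t) := by
  refine Eq.trans ?_ (app_eq t g)
  change t.hom.app (op z) (𝟙 z ≫ g) = _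
  rw [Category.id_comp]

lemma yoElt_yo_map {x y : K} (f : x ⟶ y) : yoElt ((yo K).map f) = f :=
  Category.id_comp f

instance : (yo K).Faithful where
  map_injective {_ _ f g} h := by
    rw [← yoElt_yo_map f, h, yoElt_yo_map]

instance : (yo K).Full where
  map_surjective {x y} t := ⟨yoElt t, yoElt_injective (yoElt_yo_map _)⟩

lemma surjective_app_of_epi {M N : ModCat K} (f : M ⟶ N) [Epi f] (z : Kᵒᵖ) :
    Function.Surjective (f.hom.app z) := by
  have := ObjectProperty.preservesEpimorphisms_ι_of_isNormalMonoCategory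
    (additiveFunctor Kᵒᵖ AddCommGrpCat.{v})
  have h : Epi ((additiveFunctor Kᵒᵖ AddCommGrpCat.{v}).ι.map f) := inferInstance
  have h2 := (NatTrans.epi_iff_epi_app _).1 h z
  exact (AddCommGrpCat.epi_iff_surjective _).1 h2

instance (x : K) : Projective ((yo K).obj x) where
  factors {M N} f e _ := by
    obtain ⟨m, hm⟩ := surjective_app_of_epi e (op x) (yoElt f)
    refine ⟨yoHom m, yoElt_injective ?_⟩
    rw [yoElt_comp, yoElt_yoHom, hm]

lemma hom_ext_yo {M N : ModCat K} {f g : M ⟶ N}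
    (h : ∀ (z : K) (t : (yo K).obj z ⟶ M), t ≫ f = t ≫ g) : f = g := by
  apply ObjectProperty.hom_ext
  ext z m
  obtain ⟨z⟩ := z
  have := congr_arg yoElt (h z (yoHom m))
  rwa [yoElt_comp, yoElt_comp, yoElt_yoHom] at this

lemma epi_of_lifts {M N : ModCat K} (f : M ⟶ N)
    (h : ∀ (z : K) (t : (yo K).obj z ⟶ N), ∃ s, s ≫ f = t) : Epi f where
  left_cancellation g₁ g₂ hg := hom_ext_yo fun z t => by
    obtain ⟨s, rfl⟩ := h z t
    simp [hg]

lemma isColimit_of_lifts {L M N : ModCat K} (f : L ⟶ M) (g : M ⟶ N) (w : f ≫ g = 0)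
    (h₁ : ∀ (z : K) (t : (yo K).obj z ⟶ N), ∃ s, s ≫ g = t)
    (h₂ : ∀ (z : K) (t : (yo K).obj z ⟶ M), t ≫ g = 0 → ∃ s, s ≫ f = t) :
    Nonempty (IsColimit (CokernelCofork.ofπ g w)) := by
  have := epi_of_lifts g h₁
  let S := ShortComplex.mk f g w
  have hS : S.Exact := by
    rw [S.exact_iff_epi_kernel_lift]
    refine epi_of_lifts _ fun z t => ?_
    obtain ⟨s, hs⟩ := h₂ z (t ≫ kernel.ι g) (by simp)
    refine ⟨s, ?_⟩
    rw [← cancel_mono (kernel.ι S.g)]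
    simpa using hs
  have : Epi S.g := this
  exact ⟨hS.gIsCokernel⟩

lemma lifts_of_isColimit {L M N : ModCat K} {f : L ⟶ M} {g : M ⟶ N} {w : f ≫ g = 0}
    (h : IsColimit (CokernelCofork.ofπ g w)) :
    (∀ (z : K) (t : (yo K).obj z ⟶ N), ∃ s, s ≫ g = t) ∧
    (∀ (z : K) (t : (yo K).obj z ⟶ M), t ≫ g = 0 → ∃ s, s ≫ f = t) := by
  have : Epi g := ⟨fun a b hab => Cofork.IsColimit.hom_ext h hab⟩
  refine ⟨fun z t => ⟨Projective.factorThru t g, by simp⟩, fun z t ht => ?_⟩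
  let S := ShortComplex.mk f g w
  have hS : S.Exact := S.exact_of_g_is_cokernel h
  exact ⟨hS.liftFromProjective t ht, hS.liftFromProjective_comp t ht⟩

variable (K) in
/-- Finitely presented `K`-modules: those `M` that admit a presentation `x̂₁ ⟶ x̂₀ ⟶ M ⟶ 0`
by representable modules (finite sums of representables being representable). -/
def fp : ObjectProperty (ModCat K) := fun M =>
  ∃ (x₁ x₀ : K) (a : x₁ ⟶ x₀) (π : (yo K).obj x₀ ⟶ M) (w : (yo K).map a ≫ π = 0),
    Nonempty (IsColimit (CokernelCofork.ofπ π w))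

lemma fp_iff (M : ModCat K) : fp K M ↔ ∃ (x₁ x₀ : K) (a : x₁ ⟶ x₀) (π : (yo K).obj x₀ ⟶ M),
    (yo K).map a ≫ π = 0 ∧ (∀ (z : K) (t : (yo K).obj z ⟶ M), ∃ s : z ⟶ x₀, (yo K).map s ≫ π = t) ∧
    ∀ (z : K) (t : z ⟶ x₀), (yo K).map t ≫ π = 0 → ∃ s : z ⟶ x₁, s ≫ a = t := by
  constructor
  · rintro ⟨x₁, x₀, a, π, w, ⟨h⟩⟩
    obtain ⟨h₁, h₂⟩ := lifts_of_isColimit h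
    refine ⟨x₁, x₀, a, π, w, fun z t => ?_, fun z t ht => ?_⟩
    · obtain ⟨s, hs⟩ := h₁ z t
      exact ⟨(yo K).preimage s, by simpa using hs⟩
    · obtain ⟨s, hs⟩ := h₂ z _ ht
      exact ⟨(yo K).preimage s, (yo K).map_injective (by simpa using hs)⟩
  · rintro ⟨x₁, x₀, a, π, w, h₁, h₂⟩
    refine ⟨x₁, x₀, a, π, w, isColimit_of_lifts _ _ _ (fun z t => ?_) (fun z t ht => ?_)⟩
    · obtain ⟨s, hs⟩ := h₁ z t
      exact ⟨_, hs⟩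
    · obtain ⟨t, rfl⟩ := (yo K).map_surjective t
      obtain ⟨s, rfl⟩ := h₂ z t ht
      exact ⟨(yo K).map s, by simp⟩

lemma fp_yo [HasZeroObject K] (x : K) : fp K ((yo K).obj x) := by
  rw [fp_iff]
  refine ⟨0, x, 0, 𝟙 _, by simp, fun z t => ⟨(yo K).preimage t, by simp⟩, fun z t ht => ⟨0, ?_⟩⟩
  refine (yo K).map_injective ?_
  simpa using ht.symm

instance [HasBinaryBiproducts K] : (fp K).IsClosedUnderCokernels where
  cokernels_le := by
    rintro N' ⟨f, k, hk, hM, hN⟩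
    rename_i M N
    rw [fp_iff] at hM hN ⊢
    obtain ⟨x₁, x₀, a, p, w, h₁, h₂⟩ := hM
    obtain ⟨y₁, y₀, b, q, w', h₁', h₂'⟩ := hN
    obtain ⟨c, hc⟩ := h₁' _ (p ≫ f)
    have hfk : f ≫ k.π = 0 := k.condition
    obtain ⟨l₁, l₂⟩ := lifts_of_isColimit (w := hfk)
      (hk.ofIsoColimit (Cofork.ext (Iso.refl _) (by simp)))
    refine ⟨y₁ ⊞ x₀, y₀, biprod.desc b c, q ≫ k.π, ?_, fun z t => ?_, fun z t ht => ?_⟩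
    · refine hom_ext_yo fun z t => ?_
      obtain ⟨t, rfl⟩ := (yo K).map_surjective t
      rw [comp_zero, ← Functor.map_comp_assoc, biprod.desc_eq, Preadditive.comp_add,
        Functor.map_add, Preadditive.add_comp]
      simp only [Functor.map_comp, Category.assoc, reassoc_of% w', reassoc_of% hc, hfk]
      simp
    · obtain ⟨s, rfl⟩ := l₁ z t
      obtain ⟨s, rfl⟩ := h₁' z s
      exact ⟨s, by simp⟩
    · obtain ⟨s, hs⟩ := l₂ z ((yo K).map t ≫ q) (by simpa using ht)
      obtain ⟨s, rfl⟩ := h₁ z s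
      obtain ⟨r, hr⟩ := h₂' z (t - s ≫ c) (by
        rw [Functor.map_sub, Preadditive.sub_comp, ← hs, Functor.map_comp, Category.assoc,
          Category.assoc, hc, sub_self])
      exact ⟨biprod.lift r s, by simp [hr]⟩

lemma exists_weak_pullback {C : Type*} [Category* C] [Preadditive C] [HasBinaryBiproducts C]
    [HasWeakKernels C] {x y z : C} (c : x ⟶ z) (b : y ⟶ z) :
    ∃ (w : C) (d : w ⟶ x) (e : w ⟶ y), d ≫ c = e ≫ b ∧
      ∀ (t : C) (s : t ⟶ x) (r : t ⟶ y), s ≫ c = r ≫ b → ∃ l : t ⟶ w, l ≫ d = s := by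
  let g : x ⊞ y ⟶ z := biprod.fst ≫ c - biprod.snd ≫ b
  refine ⟨weakKernel g, weakKernel.ι g ≫ biprod.fst, weakKernel.ι g ≫ biprod.snd, ?_,
    fun t s r h => ⟨weakKernel.lift g (biprod.lift s r) ?_, ?_⟩⟩
  · have := weakKernel.condition g
    rw [← sub_eq_zero]
    simpa only [g, Preadditive.comp_sub, Category.assoc] using this
  · simp [g, h]
  · simp

instance [HasBinaryBiproducts K] [HasWeakKernels K] : (fp K).IsClosedUnderKernels where
  kernels_le := by
    rintro N' ⟨f, k, hk, hM, hN⟩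
    rename_i M N
    rw [fp_iff] at hM hN ⊢
    obtain ⟨x₁, x₀, a, p, w, h₁, h₂⟩ := hM
    obtain ⟨y₁, y₀, b, q, w', h₁', h₂'⟩ := hN
    obtain ⟨c, hc⟩ := h₁' _ (p ≫ f)
    have hkf : k.ι ≫ f = 0 := k.condition
    have : Mono k.ι := ⟨fun u v huv => Fork.IsLimit.hom_ext hk huv⟩
    obtain ⟨u, d, e, hde, hu⟩ := exists_weak_pullback c b
    obtain ⟨v, g, g', hg, hv⟩ := exists_weak_pullback d a
    have hd : ((yo K).map d ≫ p) ≫ f = 0 := by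
      rw [Category.assoc, ← hc, ← Functor.map_comp_assoc, hde, Functor.map_comp_assoc, w',
        comp_zero]
    let π : (yo K).obj _ ⟶ k.pt := Fork.IsLimit.lift hk ((yo K).map d ≫ p) (by simpa using hd)
    have hπ : π ≫ k.ι = (yo K).map d ≫ p := Fork.IsLimit.lift_ι' hk _ _
    refine ⟨_, _, g, π, ?_, fun z t => ?_, fun z t ht => ?_⟩
    · rw [← cancel_mono k.ι, Category.assoc, hπ, zero_comp, ← Functor.map_comp_assoc, hg,
        Functor.map_comp_assoc, w, comp_zero]
    · obtain ⟨s, hs⟩ := h₁ z (t ≫ k.ι)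
      obtain ⟨r, hr⟩ := h₂' z (s ≫ c) (by
        rw [Functor.map_comp, Category.assoc, hc, reassoc_of% hs, hkf, comp_zero])
      obtain ⟨l, hl⟩ := hu z s r hr.symm
      refine ⟨l, ?_⟩
      rw [← cancel_mono k.ι, Category.assoc, hπ, ← hs, ← Functor.map_comp_assoc, hl]
    · have ht' : (yo K).map (t ≫ d) ≫ p = 0 := by
        rw [Functor.map_comp, Category.assoc, ← hπ, reassoc_of% ht, zero_comp]
      obtain ⟨r, hr⟩ := h₂ z _ ht'
      exact hv z t r hr.symm

instance [HasZeroObject K] : (fp K).ContainsZero where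
  exists_zero := ⟨(yo K).obj 0, (yo K).map_isZero (isZero_zero K), fp_yo 0⟩

lemma fp_biprod [HasBinaryBiproducts K] {M N : ModCat K} (hM : fp K M) (hN : fp K N) :
    fp K (M ⊞ N) := by
  rw [fp_iff] at hM hN ⊢
  obtain ⟨x₁, x₀, a, p, w, h₁, h₂⟩ := hM
  obtain ⟨y₁, y₀, b, q, w', h₁', h₂'⟩ := hN
  have key : ∀ (z : K) (t : z ⟶ x₀ ⊞ y₀),
      (yo K).map t ≫ biprod.lift ((yo K).map biprod.fst ≫ p) ((yo K).map biprod.snd ≫ q) =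
      biprod.lift ((yo K).map (t ≫ biprod.fst) ≫ p) ((yo K).map (t ≫ biprod.snd) ≫ q) := by
    intro z t
    apply biprod.hom_ext <;> simp
  refine ⟨x₁ ⊞ y₁, x₀ ⊞ y₀, biprod.map a b,
    biprod.lift ((yo K).map biprod.fst ≫ p) ((yo K).map biprod.snd ≫ q), ?_,
    fun z t => ?_, fun z t ht => ?_⟩
  · rw [key]
    apply biprod.hom_ext <;> simp [w, w']
  · obtain ⟨s, hs⟩ := h₁ z (t ≫ biprod.fst)
    obtain ⟨r, hr⟩ := h₁' z (t ≫ biprod.snd)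
    refine ⟨biprod.lift s r, ?_⟩
    rw [key]
    apply biprod.hom_ext <;> simp [hs, hr]
  · rw [key] at ht
    obtain ⟨s, hs⟩ := h₂ z (t ≫ biprod.fst) (by simpa using ht =≫ biprod.fst)
    obtain ⟨r, hr⟩ := h₂' z (t ≫ biprod.snd) (by simpa using ht =≫ biprod.snd)
    refine ⟨biprod.lift s r, ?_⟩
    ext <;> simp [hs, hr]

instance [HasBinaryBiproducts K] : (fp K).IsClosedUnderIsomorphisms where
  of_iso {M N} e hM := by
    have : IsColimit (CokernelCofork.ofπ (f := (0 : M ⟶ M)) e.hom (by simp)) :=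
      CokernelCofork.IsColimit.ofπ' _ _ fun g _ => ⟨e.inv ≫ g, by simp⟩
    exact (fp K).prop_of_isColimit_cokernelCofork this hM hM

instance [HasZeroObject K] [HasBinaryBiproducts K] : (fp K).IsClosedUnderFiniteProducts := by
  have : (fp K).IsClosedUnderBinaryProducts := by
    refine ⟨?_⟩
    rintro M ⟨h⟩
    have e : M ≅ (h.diag.obj ⟨.left⟩ ⊞ h.diag.obj ⟨.right⟩) := by
      exact h.isLimit.conePointUniqueUpToIso
        ((IsLimit.postcomposeInvEquiv (diagramIsoPair h.diag) _).symm
          (BinaryBiproduct.isLimit _ _))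
    exact (fp K).prop_of_iso e.symm (fp_biprod (h.prop_diag_obj _) (h.prop_diag_obj _))
  exact .mk'

lemma fp_elements {M : ModCat K} (hM : fp K M) :
    ∃ (x₁ x₀ : K) (a : x₁ ⟶ x₀) (p : M.obj.obj (op x₀)),
      M.obj.map a.op p = 0 ∧ (∀ (z : K) (m : M.obj.obj (op z)), ∃ s : z ⟶ x₀, M.obj.map s.op p = m) ∧
      ∀ (z : K) (t : z ⟶ x₀), M.obj.map t.op p = 0 → ∃ s : z ⟶ x₁, s ≫ a = t := by
  obtain ⟨x₁, x₀, a, p, w, h₁, h₂⟩ := (fp_iff M).1 hM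
  refine ⟨x₁, x₀, a, yoElt p, ?_, fun z m => ?_, fun z t ht => h₂ z t (yoElt_injective ?_)⟩
  · rw [← yoElt_map_comp, w]; rfl
  · obtain ⟨s, hs⟩ := h₁ z (yoHom m)
    exact ⟨s, by rw [← yoElt_map_comp, hs, yoElt_yoHom]⟩
  · rw [yoElt_map_comp, ht]; rfl

section Tensor
variable [MonoidalCategory K]

/-- A natural biadditive pairing `M(x) × N(y) ⟶ T(x ⊗ y)` of `K`-modules. -/
@[ext]
structure BiadditivePairing (M N T : ModCat K) where
  app (x y : K) : M.obj.obj (op x) →+ N.obj.obj (op y) →+ T.obj.obj (op (x ⊗ y))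
  naturality {x x' y y' : K} (f : x' ⟶ x) (g : y' ⟶ y)
    (m : M.obj.obj (op x)) (n : N.obj.obj (op y)) :
    app x' y' (M.obj.map f.op m) (N.obj.map g.op n) = T.obj.map (f ⊗ₘ g).op (app x y m n)

/-- The composite of a biadditive pairing with a morphism of its target. -/
def BiadditivePairing.postcomp {M N T T' : ModCat K} (φ : BiadditivePairing M N T) (u : T ⟶ T') :
    BiadditivePairing M N T' where
  app x y := (AddMonoidHom.compHom (u.hom.app (op (x ⊗ y))).hom).comp (φ.app x y)
  naturality f g m n := by
    change u.hom.app _ (φ.app _ _ _ _) = T'.obj.map _ (u.hom.app _ _)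
    rw [φ.naturality]
    exact congr($(u.hom.naturality (f ⊗ₘ g).op) (φ.app _ _ m n))

/-- The pairing `φ` exhibits `T` as the (additive) Day convolution product `M ⊗ N` in `Mod-K`:
morphisms `M ⊗ N ⟶ T'` are the natural biadditive pairings `M(x) × N(y) ⟶ T'(x ⊗ y)`. -/
def BiadditivePairing.IsUniversal {M N T : ModCat K} (φ : BiadditivePairing M N T) : Prop :=
  ∀ (T' : ModCat K) (ψ : BiadditivePairing M N T'), ∃! u : T ⟶ T', φ.postcomp u = ψ

lemma exists_universal_pairing [HasBinaryBiproducts K] [MonoidalPreadditive K] {M N : ModCat K}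
    (hM : fp K M) (hN : fp K N) :
    ∃ (T : ModCat K) (_ : fp K T) (φ : BiadditivePairing M N T), φ.IsUniversal := by
  obtain ⟨x₁, x₀, a, p, w, h₁, h₂⟩ := fp_elements hM
  obtain ⟨y₁, y₀, b, q, w', h₁', h₂'⟩ := fp_elements hN
  let rel : (x₁ ⊗ y₀) ⊞ (x₀ ⊗ y₁) ⟶ x₀ ⊗ y₀ := biprod.desc (a ▷ y₀) (x₀ ◁ b)
  let T : ModCat K := cokernel ((yo K).map rel)
  let π : (yo K).obj (x₀ ⊗ y₀) ⟶ T := cokernel.π _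
  have hπ : (yo K).map rel ≫ π = 0 := cokernel.condition _
  have hT : fp K T := ⟨_, _, rel, π, hπ, ⟨cokernelIsCokernel _⟩⟩
  let r : T.obj.obj (op (x₀ ⊗ y₀)) := yoElt π
  have hr : T.obj.map rel.op r = 0 := by
    rw [← yoElt_map_comp, hπ]; rfl
  have hra : T.obj.map (a ▷ y₀).op r = 0 := by
    have e : a ▷ y₀ = biprod.inl ≫ rel := by simp [rel]
    rw [e, map_comp_apply, hr, map_zero]
  have hrb : T.obj.map (x₀ ◁ b).op r = 0 := by
    have e : x₀ ◁ b = biprod.inr ≫ rel := by simp [rel]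
    rw [e, map_comp_apply, hr, map_zero]
  choose S hS using h₁
  choose S' hS' using h₁'
  have key₁ : ∀ {x y : K} (s s' : x ⟶ x₀) (t : y ⟶ y₀), M.obj.map s.op p = M.obj.map s'.op p →
      T.obj.map (s ⊗ₘ t).op r = T.obj.map (s' ⊗ₘ t).op r := by
    intro x y s s' t h
    obtain ⟨l, hl⟩ := h₂ x (s - s') (by
      rw [sub_eq_add_neg, map_add_apply, h, ← map_add_apply, ← sub_eq_add_neg, sub_self,
        map_zero_apply])
    have e : s ⊗ₘ t = (l ⊗ₘ t) ≫ (a ▷ y₀) + s' ⊗ₘ t := by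
      rw [← tensorHom_id, tensorHom_comp_tensorHom, hl, Category.comp_id,
        ← MonoidalPreadditive.add_tensor, sub_add_cancel]
    rw [e, map_add_apply, map_comp_apply, hra, map_zero, zero_add]
  have key₂ : ∀ {x y : K} (s : x ⟶ x₀) (t t' : y ⟶ y₀), N.obj.map t.op q = N.obj.map t'.op q →
      T.obj.map (s ⊗ₘ t).op r = T.obj.map (s ⊗ₘ t').op r := by
    intro x y s t t' h
    obtain ⟨l, hl⟩ := h₂' y (t - t') (by
      rw [sub_eq_add_neg, map_add_apply, h, ← map_add_apply, ← sub_eq_add_neg, sub_self,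
        map_zero_apply])
    have e : s ⊗ₘ t = (s ⊗ₘ l) ≫ (x₀ ◁ b) + s ⊗ₘ t' := by
      rw [← id_tensorHom, tensorHom_comp_tensorHom, hl, Category.comp_id,
        ← MonoidalPreadditive.tensor_add, sub_add_cancel]
    rw [e, map_add_apply, map_comp_apply, hrb, map_zero, zero_add]
  have key : ∀ {x y : K} (s s' : x ⟶ x₀) (t t' : y ⟶ y₀),
      M.obj.map s.op p = M.obj.map s'.op p → N.obj.map t.op q = N.obj.map t'.op q →
      T.obj.map (s ⊗ₘ t).op r = T.obj.map (s' ⊗ₘ t').op r :=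
    fun s s' t t' h h' => (key₁ s s' t h).trans (key₂ s' t t' h')
  let φ : BiadditivePairing M N T :=
    { app := fun x y => AddMonoidHom.mk' (fun m => AddMonoidHom.mk'
          (fun n => T.obj.map (S x m ⊗ₘ S' y n).op r) (fun n n' => by
            rw [← map_add_apply, ← MonoidalPreadditive.tensor_add]
            exact key₂ _ _ _ (by rw [map_add_apply, hS', hS', hS'])))
          (fun m m' => by
            ext n
            change T.obj.map (S x (m + m') ⊗ₘ S' y n).op r =
              T.obj.map (S x m ⊗ₘ S' y n).op r + T.obj.map (S x m' ⊗ₘ S' y n).op r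
            rw [← map_add_apply, ← MonoidalPreadditive.add_tensor]
            exact key₁ _ _ _ (by rw [map_add_apply, hS, hS, hS]))
      naturality := fun {x x' y y'} f g m n => by
        change T.obj.map (S x' _ ⊗ₘ S' y' _).op r = T.obj.map _ (T.obj.map (S x m ⊗ₘ S' y n).op r)
        rw [← map_comp_apply, tensorHom_comp_tensorHom]
        exact key _ _ _ _ (by rw [map_comp_apply, hS, hS]) (by rw [map_comp_apply, hS', hS']) }
  have hφ : ∀ (x y : K) (m : M.obj.obj (op x)) (n : N.obj.obj (op y)),
      φ.app x y m n = T.obj.map (S x m ⊗ₘ S' y n).op r := fun _ _ _ _ => rfl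
  have hφr : φ.app x₀ y₀ p q = r := by
    rw [hφ, key _ (𝟙 x₀) _ (𝟙 y₀) (by rw [hS, map_id_apply]) (by rw [hS', map_id_apply]),
      id_tensorHom_id, map_id_apply]
  refine ⟨T, hT, φ, fun T' ψ => ?_⟩
  have hψ : (yo K).map rel ≫ yoHom (ψ.app x₀ y₀ p q) = 0 := by
    have e₁ : (yo K).map (a ▷ y₀) ≫ yoHom (ψ.app x₀ y₀ p q) = 0 := by
      apply yoElt_injective
      rw [yoElt_map_comp, yoElt_yoHom, ← tensorHom_id, ← ψ.naturality, w, map_zero]; rfl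
    have e₂ : (yo K).map (x₀ ◁ b) ≫ yoHom (ψ.app x₀ y₀ p q) = 0 := by
      apply yoElt_injective
      rw [yoElt_map_comp, yoElt_yoHom, ← id_tensorHom, ← ψ.naturality, w', map_zero]; rfl
    rw [show rel = biprod.fst ≫ a ▷ y₀ + biprod.snd ≫ x₀ ◁ b from biprod.desc_eq,
      Functor.map_add, Preadditive.add_comp, Functor.map_comp_assoc, Functor.map_comp_assoc,
      e₁, e₂, comp_zero, comp_zero, add_zero]
  refine ⟨cokernel.desc _ (yoHom (ψ.app x₀ y₀ p q)) hψ, ?_, fun u hu => ?_⟩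
  · set u : T ⟶ T' := cokernel.desc _ (yoHom (ψ.app x₀ y₀ p q)) hψ
    have hu : u.hom.app _ r = ψ.app x₀ y₀ p q := by
      have : yoElt (π ≫ u) = ψ.app x₀ y₀ p q := by
        rw [cokernel.π_desc, yoElt_yoHom]
      exact this
    apply BiadditivePairing.ext
    ext x y m n
    change u.hom.app _ (T.obj.map (S x m ⊗ₘ S' y n).op r) = ψ.app x y m n
    refine (congr($(u.hom.naturality (S x m ⊗ₘ S' y n).op) r)).trans ?_
    change T'.obj.map _ (u.hom.app _ r) = _
    rw [hu, ← ψ.naturality, hS, hS']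
  · rw [← cancel_epi (cokernel.π ((yo K).map rel)), cokernel.π_desc]
    apply yoElt_injective
    rw [yoElt_yoHom]
    change u.hom.app _ r = _
    rw [← hu, ← hφr]
    rfl
end Tensor

/-- The localizing subcategory generated by `P`: the smallest Serre subcategory of `Mod-K` that
contains `P` and is closed under (small) coproducts. -/
def localizingClosure (P : ObjectProperty (ModCat K)) : ObjectProperty (ModCat K) := fun M =>
  ∀ L : ObjectProperty (ModCat K), L.IsSerreClass →
    (∀ J : Type v, L.IsClosedUnderColimitsOfShape (Discrete J)) → P ≤ L → L M

instance (P : ObjectProperty (ModCat K)) : (localizingClosure P).IsSerreClass where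
  exists_zero := ⟨0, isZero_zero _, fun L _ _ _ => L.prop_of_isZero (isZero_zero _)⟩
  prop_of_mono f _ hY := fun L hL hJ hP => L.prop_of_mono f (hY L hL hJ hP)
  prop_of_epi f _ hY := fun L hL hJ hP => L.prop_of_epi f (hY L hL hJ hP)
  prop_X₂_of_shortExact hS h₁ h₃ := fun L hL hJ hP =>
    L.prop_X₂_of_shortExact hS (h₁ L hL hJ hP) (h₃ L hL hJ hP)

end Modules

section FinitelyPresented

variable (K : Type u) [Category.{v} K] [Preadditive K] [HasZeroObject K] [HasBinaryBiproducts K]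
  [HasWeakKernels K]

/-- `mod-K`: the category of finitely presented `K`-modules (the Freyd envelope of `K`). -/
abbrev FPMod := (fp K).FullSubcategory

/-- `mod-K` is abelian (kernels and cokernels being computed in `Mod-K`). -/
instance : Abelian (FPMod K) := inferInstance

/-- The Yoneda embedding `h : K ⥤ mod-K`. -/
def yoFP : K ⥤ FPMod K := (fp K).lift (yo K) fp_yo

variable {K}

/-- The tensor product of `mod-K`: the Day convolution product of two finitely presented modules,
which is again finitely presented. -/
def tensorFP [MonoidalCategory K] [MonoidalPreadditive K] (M N : FPMod K) : FPMod K :=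
  ⟨(exists_universal_pairing M.property N.property).choose,
    (exists_universal_pairing M.property N.property).choose_spec.choose⟩

/-- The universal pairing that exhibits `tensorFP M N` as the Day convolution product. -/
def tensorFPPairing [MonoidalCategory K] [MonoidalPreadditive K] (M N : FPMod K) :
    BiadditivePairing M.obj N.obj (tensorFP M N).obj :=
  (exists_universal_pairing M.property N.property).choose_spec.choose_spec.choose

lemma tensorFPPairing_isUniversal [MonoidalCategory K] [MonoidalPreadditive K] (M N : FPMod K) :
    (tensorFPPairing M N).IsUniversal :=
  (exists_universal_pairing M.property N.property).choose_spec.choose_spec.choose_spec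

/-- Serre `⊗`-ideals of `mod-K` (the tensor product being symmetric when `K` is). -/
structure IsSerreTensorIdeal [MonoidalCategory K] [MonoidalPreadditive K]
    (B : ObjectProperty (FPMod K)) : Prop where
  isSerreClass : B.IsSerreClass
  tensor_mem : ∀ M N : FPMod K, B M → B (tensorFP M N)

variable (K) in
/-- A homological prime: a maximal proper Serre `⊗`-ideal of `mod-K`. -/
structure HomologicalPrime [MonoidalCategory K] [MonoidalPreadditive K] where
  carrier : ObjectProperty (FPMod K)
  isSerreTensorIdeal : IsSerreTensorIdeal carrier
  ne_top : carrier ≠ ⊤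
  maximal : ∀ C : ObjectProperty (FPMod K), IsSerreTensorIdeal C → carrier ≤ C → C ≠ ⊤ →
    C = carrier

/-- The localizing subcategory `⟨B⟩` of `Mod-K` generated by a class `B` of objects of `mod-K`. -/
abbrev generatedLocalizing (B : ObjectProperty (FPMod K)) : ObjectProperty (ModCat K) :=
  localizingClosure (B.map (fp K).ι)

/-- The Gabriel quotient `(Mod-K)/⟨B⟩`. -/
abbrev ResidueCategory (B : ObjectProperty (FPMod K)) :=
  (generatedLocalizing B).isoModSerre.Localization

/-- The functor `h̄_B = Q_B ∘ h : K ⥤ Mod-K ⥤ (Mod-K)/⟨B⟩`. -/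
def residueFunctor (B : ObjectProperty (FPMod K)) : K ⥤ ResidueCategory B :=
  yo K ⋙ (generatedLocalizing B).isoModSerre.Q

end FinitelyPresented

section TensorTriangulated

variable (K : Type u) [Category.{v} K] [Preadditive K] [HasZeroObject K] [HasShift K ℤ]
  [∀ n : ℤ, (shiftFunctor K n).Additive] [Pretriangulated K] [MonoidalCategory K]

/-- Compatibility of a tensor product with a triangulation: the tensor product is exact (i.e. a
triangulated functor) in each variable, and in particular additive. -/
class IsTensorTriangulated : Prop extends MonoidalPreadditive K where
  exact_tensorLeft : ∀ x : K, ∃ _ : (tensorLeft x).CommShift ℤ, (tensorLeft x).IsTriangulated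
  exact_tensorRight : ∀ x : K, ∃ _ : (tensorRight x).CommShift ℤ, (tensorRight x).IsTriangulated

variable {K}

/-- Thick `⊗`-ideals of `K`. -/
structure IsThickTensorIdeal (P : ObjectProperty K) : Prop where
  isTriangulated : P.IsTriangulated
  isStableUnderRetracts : P.IsStableUnderRetracts
  tensor_mem : ∀ x y : K, P x → P (x ⊗ y)

variable (K) in
/-- The points of the triangular spectrum `Spc(K)`: the prime (proper) thick `⊗`-ideals. -/
structure Spc where
  carrier : ObjectProperty K
  isThickTensorIdeal : IsThickTensorIdeal carrier
  ne_top : carrier ≠ ⊤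
  prime : ∀ x y : K, carrier (x ⊗ y) → carrier x ∨ carrier y

/-- The support of an object, as a subset of the spectrum. -/
def supp (x : K) : Set (Spc K) := {P | ¬ P.carrier x}

/-- The topology of the spectrum, for which the supports form a basis of closed subsets. -/
instance : TopologicalSpace (Spc K) :=
  TopologicalSpace.generateFrom (Set.range fun x : K => (supp x)ᶜ)

/-- Thomason closed subsets: closed subsets with quasi-compact open complement. -/
def IsThomasonClosed (Z : Set (Spc K)) : Prop := IsClosed Z ∧ IsCompact Zᶜ

/-- A homological prime `B` lives over `W` if the triangular prime `h⁻¹(B)` belongs to `W`. -/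
def HomologicalPrime.LivesOver [MonoidalPreadditive K] (B : HomologicalPrime K)
    (W : Set (Spc K)) : Prop :=
  ∃ P ∈ W, P.carrier = B.carrier.inverseImage (yoFP K)

end TensorTriangulated

section TensorPowers

variable {C : Type u} [Category.{v} C] [MonoidalCategory C]

/-- The tensor power `x^{⊗n}`. -/
def tensorPow (x : C) : ℕ → C
  | 0 => 𝟙_ C
  | n + 1 => tensorPow x n ⊗ x

/-- The tensor power `f^{⊗n} : x^{⊗n} ⟶ y^{⊗n}` of a morphism. -/
def tensorPowMap {x y : C} (f : x ⟶ y) : (n : ℕ) → (tensorPow x n ⟶ tensorPow y n)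
  | 0 => 𝟙 (𝟙_ C)
  | n + 1 => tensorPowMap f n ⊗ₘ f

end TensorPowers

end

end TTGeom

/-!
The argument plays the ideal of modules on which `f` is `⊗`-nilpotent against homological primes
produced by Zorn's lemma.

For a morphism `f : x ⟶ y` of `K`, the finitely presented modules on which some power `f^{⊗n}`
vanishes form a Serre `⊗`-ideal `nilIdeal f` of `mod-K`: if `f^{⊗m}` vanishes on a quotient and
`f^{⊗n}` on the corresponding submodule, then `f^{⊗(m+n)}` vanishes on the module. Let
`φ : x ⊗ ᘁy ⟶ 𝟙` be the adjunct of `f`. Then `f` kills the cokernel of `φ̂`, so this cokernel lies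
in `nilIdeal f`. If a homological prime `B` contains `nilIdeal f` and `h̄_B(f) = 0`, then `B` also
contains the image of `φ̂`, hence the unit, which is absurd
(`HomologicalPrime.residueFunctor_map_ne_zero`).

Given a Serre `⊗`-ideal and a `⊗`-multiplicative class `S` of objects of `K` that do not lie in it,
a Serre `⊗`-ideal `B` that contains the given one and is maximal among those avoiding `S` is a
homological prime (`exists_homologicalPrime`). Indeed for `s ∈ S` the ideal quotient `(B : ŝ)` still
avoids `S`, so it equals `B`; it contains the cokernel of `s ⊗ ᘁs ⟶ 𝟙`, which is annihilated by `ŝ`.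
Hence a Serre `⊗`-ideal that contains `B` and some `ŝ` contains the unit.

Apply this to `nilIdeal f` and the class of all `s` with `W ⊆ supp s`. A homological prime avoiding
this class lives over the closed set `W`, so by hypothesis there is none, and therefore some `s`
with `W ⊆ supp s` lies in `nilIdeal f`. Take `Z = supp s`. The same construction of homological
primes shows that `supp z ⊆ supp s` forces `z ∈ nilIdeal f`
(`IsSerreTensorIdeal.mem_of_supp_subset`) and that the complement of `supp s` is quasi-compact
(`isCompact_compl_supp`).

Computations modulo a Serre subcategory `B` of `mod-K` are carried out with the morphisms `a` of `K`
such that `coker â` lies in `B`, called `Dense` below. They define the localizing subcategory of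
`Torsion` modules, which contains `⟨B⟩` and has the same finitely presented objects as `B`; so
`h̄_B(f) = 0` implies that `f` vanishes on some dense morphism (`exists_dense_comp_eq_zero`).
-/

set_option linter.unusedSectionVars false

namespace TTGeom
noncomputable section

/-! ### Elements of finitely presented modules -/

section FinitelyPresentedModules

variable {K : Type u} [Category.{v} K] [Preadditive K] [HasZeroObject K] [HasBinaryBiproducts K]
  [HasWeakKernels K]

/-- The morphism `x̂ ⟶ M` of `mod-K` classified by an element of `M(x)`. -/
def fpHom {x : K} {M : FPMod K} (m : M.obj.obj.obj (op x)) : (yoFP K).obj x ⟶ M :=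
  ObjectProperty.homMk (yoHom m)

/-- The element of `M(x)` that corresponds to a morphism `x̂ ⟶ M` of `mod-K`. -/
def fpElt {x : K} {M : FPMod K} (t : (yoFP K).obj x ⟶ M) : M.obj.obj.obj (op x) :=
  yoElt t.hom

lemma fpElt_fpHom {x : K} {M : FPMod K} (m : M.obj.obj.obj (op x)) : fpElt (fpHom m) = m :=
  yoElt_yoHom m

lemma fpElt_injective {x : K} {M : FPMod K} {s t : (yoFP K).obj x ⟶ M}
    (h : fpElt s = fpElt t) : s = t :=
  ObjectProperty.hom_ext _ (yoElt_injective h)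

lemma fpElt_zero {x : K} {M : FPMod K} : fpElt (0 : (yoFP K).obj x ⟶ M) = 0 := rfl

lemma fpElt_comp {x : K} {M N : FPMod K} (t : (yoFP K).obj x ⟶ M) (f : M ⟶ N) :
    fpElt (t ≫ f) = f.hom.hom.app (op x) (fpElt t) := rfl

lemma fpElt_map_comp {x z : K} {M : FPMod K} (g : z ⟶ x) (t : (yoFP K).obj x ⟶ M) :
    fpElt ((yoFP K).map g ≫ t) = M.obj.obj.map g.op (fpElt t) :=
  yoElt_map_comp g t.hom

lemma map_fpHom {x z : K} {M : FPMod K} (g : z ⟶ x) (m : M.obj.obj.obj (op x)) :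
    (yoFP K).map g ≫ fpHom m = fpHom (M.obj.obj.map g.op m) := by
  apply fpElt_injective
  rw [fpElt_map_comp, fpElt_fpHom, fpElt_fpHom]

lemma fpHom_comp {x : K} {M N : FPMod K} (m : M.obj.obj.obj (op x)) (f : M ⟶ N) :
    fpHom m ≫ f = fpHom (f.hom.hom.app (op x) m) := by
  apply fpElt_injective
  rw [fpElt_comp, fpElt_fpHom, fpElt_fpHom]

lemma fpHom_eq_zero_iff {x : K} {M : FPMod K} {m : M.obj.obj.obj (op x)} :
    fpHom m = 0 ↔ m = 0 := by
  constructor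
  · intro h
    rw [← fpElt_fpHom m, h, fpElt_zero]
  · rintro rfl
    exact fpElt_injective (by rw [fpElt_fpHom, fpElt_zero])

instance : (yoFP K).Full := inferInstanceAs ((fp K).lift (yo K) fp_yo).Full
instance : (yoFP K).Faithful := inferInstanceAs ((fp K).lift (yo K) fp_yo).Faithful
instance : (yoFP K).Additive := inferInstanceAs ((fp K).lift (yo K) fp_yo).Additive

/-- Morphisms of `mod-K` can be compared on elements. -/
lemma fp_hom_ext {M N : FPMod K} {f g : M ⟶ N}
    (h : ∀ (z : K) (m : M.obj.obj.obj (op z)), fpHom m ≫ f = fpHom m ≫ g) : f = g := by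
  apply ObjectProperty.hom_ext
  refine hom_ext_yo fun z t => ?_
  have := congr($(h z (yoElt t)).hom)
  have e : (fpHom (M := M) (yoElt t)).hom = t := yoElt_injective (yoElt_yoHom _)
  rw [← e]
  exact this

lemma fp_injective_of_mono {M N : FPMod K} (f : M ⟶ N) [Mono f] {z : K}
    {m : M.obj.obj.obj (op z)} (hm : f.hom.hom.app (op z) m = 0) : m = 0 := by
  rw [← fpHom_eq_zero_iff, ← cancel_mono f, fpHom_comp, hm, zero_comp, fpHom_eq_zero_iff]

lemma fp_epi_of_surjective {M N : FPMod K} (f : M ⟶ N)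
    (h : ∀ (z : K), Function.Surjective (f.hom.hom.app (op z))) : Epi f where
  left_cancellation g₁ g₂ hg := fp_hom_ext fun z n => by
    obtain ⟨m, rfl⟩ := h z n
    rw [← fpHom_comp, Category.assoc, Category.assoc, hg]

/-- Epimorphisms of `mod-K` are pointwise surjective, as `mod-K` is closed under the cokernels of
`Mod-K`. -/
lemma fp_surjective_of_epi {M N : FPMod K} (f : M ⟶ N) [Epi f] (z : K) :
    Function.Surjective (f.hom.hom.app (op z)) := by
  have : Epi f.hom := by
    have hC : fp K (cokernel f.hom) :=
      (fp K).prop_of_isColimit_cokernelCofork (colimit.isColimit _) M.property N.property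
    let q : N ⟶ (⟨cokernel f.hom, hC⟩ : FPMod K) := ObjectProperty.homMk (cokernel.π f.hom)
    have hq : q = 0 := by
      rw [← cancel_epi f, comp_zero]
      exact ObjectProperty.hom_ext _ (cokernel.condition f.hom)
    have : cokernel.π f.hom = 0 := congr($(hq).hom)
    exact Preadditive.epi_of_cokernel_zero this
  exact surjective_app_of_epi f.hom (op z)

lemma fp_exists_of_exact {S : ShortComplex (FPMod K)} (hS : S.Exact) [Mono S.f] {z : K}
    {m : S.X₂.obj.obj.obj (op z)} (hm : S.g.hom.hom.app (op z) m = 0) :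
    ∃ l : S.X₁.obj.obj.obj (op z), S.f.hom.hom.app (op z) l = m := by
  have h : fpHom m ≫ S.g = 0 := by rw [fpHom_comp, hm, fpHom_eq_zero_iff]
  refine ⟨fpElt (hS.lift _ h), ?_⟩
  rw [← fpElt_comp, hS.lift_f, fpElt_fpHom]

lemma surjective_cokernel_π {x y : K} (a : y ⟶ x) {z : K}
    (m : (cokernel ((yoFP K).map a)).obj.obj.obj (op z)) :
    ∃ t : z ⟶ x, fpHom m = (yoFP K).map t ≫ cokernel.π ((yoFP K).map a) := by
  obtain ⟨t, ht⟩ := fp_surjective_of_epi (cokernel.π ((yoFP K).map a)) z m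
  refine ⟨t, fpElt_injective ?_⟩
  rw [fpElt_comp, fpElt_fpHom, ← ht]
  congr 1
  exact (yoElt_yo_map t).symm

end FinitelyPresentedModules

/-! ### Dense morphisms and torsion modules -/

section DenseMorphisms

variable {K : Type u} [Category.{v} K] [Preadditive K] [HasZeroObject K] [HasBinaryBiproducts K]
  [HasWeakKernels K]

/-- The annihilator of an element of a finitely presented module is the sieve generated by a single
morphism. -/
lemma exists_annihilator_cover (M : FPMod K) {x : K} (m : M.obj.obj.obj (op x)) :
    ∃ (y : K) (a : y ⟶ x), M.obj.obj.map a.op m = 0 ∧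
      ∀ (z : K) (t : z ⟶ x), M.obj.obj.map t.op m = 0 → ∃ r : z ⟶ y, r ≫ a = t := by
  obtain ⟨_, y, -, q, -, hq, -⟩ := fp_elements (kernel (fpHom m)).property
  obtain ⟨a, ha⟩ := (yoFP K).map_surjective (fpHom q ≫ kernel.ι (fpHom m))
  refine ⟨y, a, ?_, fun z t ht => ?_⟩
  · rw [← fpHom_eq_zero_iff, ← map_fpHom, ha, Category.assoc, kernel.condition, comp_zero]
  · have h : (yoFP K).map t ≫ fpHom m = 0 := by rw [map_fpHom, ht, fpHom_eq_zero_iff]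
    obtain ⟨r, hr⟩ := hq z (fpElt (kernel.lift _ _ h))
    refine ⟨r, (yoFP K).map_injective ?_⟩
    rw [Functor.map_comp, ha, reassoc_of% (map_fpHom r q), hr]
    have e : fpHom (fpElt (kernel.lift _ _ h)) = kernel.lift _ _ h :=
      fpElt_injective (fpElt_fpHom _)
    rw [e, kernel.lift_ι]

instance (x : K) : Projective ((yoFP K).obj x) where
  factors {M N} f e _ := by
    obtain ⟨m, hm⟩ := fp_surjective_of_epi e x (fpElt f)
    exact ⟨fpHom m, fpElt_injective (by rw [fpElt_comp, fpElt_fpHom, hm])⟩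

/-- A morphism `a : y ⟶ x` is dense for a class `B` of finitely presented modules if the sieve of
morphisms that factor through `a` contains the annihilator of some element `m ∈ M(x)` of a module
`M` in `B`. For a Serre class this means that `coker â` belongs to `B`
(see `Dense.cokernel_mem`). -/
def Dense (B : ObjectProperty (FPMod K)) {y x : K} (a : y ⟶ x) : Prop :=
  ∃ (M : FPMod K) (_ : B M) (m : M.obj.obj.obj (op x)),
    ∀ (z : K) (t : z ⟶ x), M.obj.obj.map t.op m = 0 → ∃ r : z ⟶ y, r ≫ a = t

/-- A `K`-module is torsion for `B` if each of its elements is annihilated by a `B`-dense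
morphism. For a Serre class `B` the torsion modules form a localizing subcategory of `Mod-K`
whose finitely presented objects are those of `B`. -/
def Torsion (B : ObjectProperty (FPMod K)) (M : ModCat K) : Prop :=
  ∀ (z : K) (m : M.obj.obj (op z)), ∃ (z' : K) (a : z' ⟶ z), Dense B a ∧ M.obj.map a.op m = 0

variable {B : ObjectProperty (FPMod K)}

lemma Dense.of_factors {x y y' : K} {a : y ⟶ x} {a' : y' ⟶ x} (ha : Dense B a) (b : y ⟶ y')
    (h : b ≫ a' = a) : Dense B a' := by
  obtain ⟨M, hM, m, hm⟩ := ha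
  refine ⟨M, hM, m, fun z t ht => ?_⟩
  obtain ⟨r, rfl⟩ := hm z t ht
  exact ⟨r ≫ b, by rw [Category.assoc, h]⟩

lemma Dense.mono {C : ObjectProperty (FPMod K)} (h : B ≤ C) {x y : K} {a : y ⟶ x}
    (ha : Dense B a) : Dense C a := by
  obtain ⟨M, hM, hm⟩ := ha
  exact ⟨M, h M hM, hm⟩

lemma Dense.exists_pullback {x y z : K} {a : y ⟶ x} (ha : Dense B a) (s : z ⟶ x) :
    ∃ (w : K) (d : w ⟶ z) (e : w ⟶ y), Dense B d ∧ d ≫ s = e ≫ a := by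
  obtain ⟨M, hM, m, hm⟩ := ha
  obtain ⟨w, d, e, hde, h⟩ := exists_weak_pullback s a
  refine ⟨w, d, e, ⟨M, hM, M.obj.obj.map s.op m, fun z t ht => ?_⟩, hde⟩
  rw [← map_comp_apply] at ht
  obtain ⟨r, hr⟩ := hm z _ ht
  exact h z t r hr.symm

lemma torsion_of_mem {M : FPMod K} (hM : B M) : Torsion B M.obj := by
  intro z m
  obtain ⟨y, a, ha, h⟩ := exists_annihilator_cover M m
  exact ⟨y, a, ⟨M, hM, m, h⟩, ha⟩

variable [B.IsSerreClass]

variable (B) in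
lemma dense_id (x : K) : Dense B (𝟙 x) := by
  obtain ⟨Z, -, hZ⟩ := B.exists_prop_of_containsZero
  exact ⟨Z, hZ, 0, fun z t _ => ⟨t, Category.comp_id t⟩⟩

/-- If `M ∈ B` and `m ∈ M(x)` witness that `a : y ⟶ x` is dense, then `coker â` is a quotient of the
image of `m : x̂ ⟶ M`. -/
lemma Dense.cokernel_mem {x y : K} {a : y ⟶ x} (ha : Dense B a) :
    B (cokernel ((yoFP K).map a)) := by
  obtain ⟨M, hM, m, hm⟩ := ha
  have hI : B (image (fpHom m)) := B.prop_of_mono (image.ι (fpHom m)) hM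
  have h : kernel.ι (factorThruImage (fpHom m)) ≫ cokernel.π ((yoFP K).map a) = 0 := by
    refine fp_hom_ext fun z l => ?_
    obtain ⟨t, ht⟩ := (yoFP K).map_surjective (fpHom l ≫ kernel.ι (factorThruImage (fpHom m)))
    have ht' : (yoFP K).map t ≫ fpHom m = 0 := by
      have e : kernel.ι (factorThruImage (fpHom m)) ≫ fpHom m = 0 := by
        refine (congr_arg (kernel.ι (factorThruImage (fpHom m)) ≫ ·)
          (image.fac (fpHom m)).symm).trans ?_
        rw [kernel.condition_assoc, zero_comp]
      rw [ht, Category.assoc, e, comp_zero]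
    rw [map_fpHom, fpHom_eq_zero_iff] at ht'
    obtain ⟨r, rfl⟩ := hm z t ht'
    rw [← Category.assoc, ← ht, Functor.map_comp, Category.assoc, cokernel.condition, comp_zero,
      comp_zero]
  have : Epi (Abelian.epiDesc (factorThruImage (fpHom m)) _ h) :=
    epi_of_epi_fac (Abelian.comp_epiDesc _ _ h)
  exact B.prop_of_epi (Abelian.epiDesc (factorThruImage (fpHom m)) _ h) hI

lemma dense_of_cokernel_mem {x y : K} {a : y ⟶ x} (h : B (cokernel ((yoFP K).map a))) :
    Dense B a := by
  refine ⟨_, h, fpElt (cokernel.π ((yoFP K).map a)), fun z t ht => ?_⟩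
  rw [← fpElt_map_comp] at ht
  have ht : (yoFP K).map t ≫ cokernel.π ((yoFP K).map a) = 0 :=
    fpElt_injective (ht.trans fpElt_zero.symm)
  have hS := ShortComplex.exact_cokernel ((yoFP K).map a)
  obtain ⟨r, hr⟩ := (yoFP K).map_surjective (hS.liftFromProjective _ ht)
  exact ⟨r, (yoFP K).map_injective (by
    rw [Functor.map_comp, hr]; exact hS.liftFromProjective_comp _ ht)⟩

/-- Dense morphisms compose: the cokernel of a composite is an extension of a quotient of one of the
cokernels by a quotient of the other. -/
lemma Dense.comp {x y z : K} {b : z ⟶ y} {a : y ⟶ x} (hb : Dense B b) (ha : Dense B a) :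
    Dense B (b ≫ a) := by
  let p := cokernel.π ((yoFP K).map (b ≫ a))
  have hp : (yoFP K).map b ≫ (yoFP K).map a ≫ p = 0 := by
    rw [← Functor.map_comp_assoc, cokernel.condition]
  let h : cokernel ((yoFP K).map b) ⟶ cokernel ((yoFP K).map (b ≫ a)) :=
    cokernel.desc _ ((yoFP K).map a ≫ p) hp
  have hq : (yoFP K).map a ≫ p ≫ cokernel.π h = 0 := by
    rw [← Category.assoc, ← cokernel.π_desc _ _ hp, Category.assoc, cokernel.condition, comp_zero]
  have : Epi (cokernel.desc _ _ hq) := epi_of_epi_fac (cokernel.π_desc _ _ hq)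
  have h₃ : B (cokernel h) := B.prop_of_epi (cokernel.desc _ _ hq) ha.cokernel_mem
  exact dense_of_cokernel_mem
    (B.prop_X₂_of_exact (ShortComplex.exact_cokernel h) hb.cokernel_mem h₃)

lemma Dense.exists_common_refinement {x y y' : K} {a : y ⟶ x} {a' : y' ⟶ x} (ha : Dense B a)
    (ha' : Dense B a') :
    ∃ (w : K) (b : w ⟶ y) (b' : w ⟶ y'), Dense B (b ≫ a) ∧ b ≫ a = b' ≫ a' := by
  obtain ⟨w, b, b', hb, h⟩ := ha'.exists_pullback a
  exact ⟨w, b, b', hb.comp ha, h⟩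

/-- A finitely presented torsion module is a quotient of `coker â` for some dense `a`. -/
lemma mem_of_torsion {M : FPMod K} (hM : Torsion B M.obj) : B M := by
  obtain ⟨_, x, -, p, -, hp, -⟩ := fp_elements M.property
  obtain ⟨y, a, ha, hap⟩ := hM x p
  have h : (yoFP K).map a ≫ fpHom p = 0 := by rw [map_fpHom, hap, fpHom_eq_zero_iff]
  have : Epi (fpHom p) := fp_epi_of_surjective _ fun z m => by
    obtain ⟨s, hs⟩ := hp z m
    exact ⟨s, hs⟩
  have : Epi (cokernel.desc _ _ h) := epi_of_epi_fac (cokernel.π_desc _ _ h)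
  exact B.prop_of_epi (cokernel.desc _ _ h) ha.cokernel_mem

lemma mem_iff_torsion (M : FPMod K) : B M ↔ Torsion B M.obj :=
  ⟨torsion_of_mem, mem_of_torsion⟩

lemma mem_yoFP_iff (x : K) : B ((yoFP K).obj x) ↔ Dense B (0 : x ⟶ x) := by
  rw [mem_iff_torsion (B := B)]
  constructor
  · intro h
    obtain ⟨y, a, ha, ha'⟩ := h x (𝟙 x)
    have ha'' : a = 0 := (Category.comp_id a).symm.trans ha'
    subst ha''
    exact ha.of_factors 0 zero_comp
  · intro h z m
    obtain ⟨w, d, e, hd, hde⟩ := h.exists_pullback (show z ⟶ x from m)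
    exact ⟨w, d, hd, by rw [comp_zero] at hde; exact hde⟩

lemma mem_yoFP_of_dense_zero {x y : K} (h : Dense B (0 : y ⟶ x)) : B ((yoFP K).obj x) :=
  (mem_yoFP_iff x).2 (h.of_factors 0 zero_comp)

lemma mem_yoFP_of_retract {x y : K} (i : x ⟶ y) (r : y ⟶ x) (h : i ≫ r = 𝟙 x)
    (hy : B ((yoFP K).obj y)) : B ((yoFP K).obj x) := by
  have : Mono ((yoFP K).map i) := mono_of_mono_fac
    (show (yoFP K).map i ≫ (yoFP K).map r = 𝟙 _ by rw [← Functor.map_comp, h, (yoFP K).map_id])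
  exact B.prop_of_mono ((yoFP K).map i) hy

/-- The objects `x` of `K` with `x̂ ∈ B` are closed under extensions, a weak kernel sequence
`x ⟶ y ⟶ z` being exact in `mod-K`. -/
lemma mem_yoFP_of_exact {x y z : K} {f : x ⟶ y} {g : y ⟶ z}
    (h : ∀ (w : K) (t : w ⟶ y), t ≫ g = 0 → ∃ r : w ⟶ x, r ≫ f = t)
    (hx : B ((yoFP K).obj x)) (hz : B ((yoFP K).obj z)) : B ((yoFP K).obj y) := by
  rw [mem_yoFP_iff (B := B)] at hx hz
  obtain ⟨w, d, e, hd, hde⟩ := hz.exists_pullback g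
  rw [comp_zero] at hde
  obtain ⟨r, rfl⟩ := h w d hde
  obtain ⟨w', d', e', hd', hde'⟩ := hx.exists_pullback r
  have := hd'.comp hd
  rw [← Category.assoc, hde', comp_zero, zero_comp] at this
  exact mem_yoFP_of_dense_zero this

/-- The torsion elements of `M(z)`. -/
def torsionSubgroup (B : ObjectProperty (FPMod K)) [B.IsSerreClass] (M : ModCat K) (z : K) :
    AddSubgroup (M.obj.obj (op z)) where
  carrier := {m | ∃ (z' : K) (a : z' ⟶ z), Dense B a ∧ M.obj.map a.op m = 0}
  zero_mem' := ⟨z, 𝟙 z, dense_id B z, map_zero _⟩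
  add_mem' := by
    rintro m m' ⟨y, a, ha, h⟩ ⟨y', a', ha', h'⟩
    obtain ⟨w, b, b', hb, e⟩ := ha.exists_common_refinement ha'
    refine ⟨w, b ≫ a, hb, ?_⟩
    rw [map_add, map_comp_apply, h, map_zero, e, map_comp_apply, h', map_zero, add_zero]
  neg_mem' := by
    rintro m ⟨y, a, ha, h⟩
    exact ⟨y, a, ha, by rw [map_neg, h, neg_zero]⟩

lemma map_mem_torsionSubgroup {M : ModCat K} {y z : K} (g : y ⟶ z) {m : M.obj.obj (op z)}
    (hm : m ∈ torsionSubgroup B M z) : M.obj.map g.op m ∈ torsionSubgroup B M y := by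
  obtain ⟨z', a, ha, h⟩ := hm
  obtain ⟨w, d, e, hd, hde⟩ := ha.exists_pullback g
  exact ⟨w, d, hd, by rw [← map_comp_apply, hde, map_comp_apply, h, map_zero]⟩

variable (B) in
/-- The largest torsion submodule of a `K`-module. -/
def torsionSubmodule (M : ModCat K) : ModCat K where
  obj :=
    { obj := fun z => AddCommGrpCat.of (torsionSubgroup B M z.unop)
      map := fun {y z} g => AddCommGrpCat.ofHom
        (((M.obj.map g).hom.comp (torsionSubgroup B M y.unop).subtype).codRestrict
          (torsionSubgroup B M z.unop) fun m => map_mem_torsionSubgroup g.unop m.2)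
      map_id := fun z => by
        ext m
        exact map_id_apply M m.1
      map_comp := fun f g => by
        ext m
        exact map_comp_apply M g.unop f.unop m.1 }
  property := ⟨fun {_ _ f g} => by
    ext m
    exact map_add_apply M f.unop g.unop m.1⟩

variable (B) in
/-- The inclusion of the largest torsion submodule. -/
def torsionSubmoduleι (M : ModCat K) : torsionSubmodule B M ⟶ M :=
  ObjectProperty.homMk
    { app := fun z => AddCommGrpCat.ofHom (torsionSubgroup B M z.unop).subtype
      naturality := fun _ _ _ => rfl }

instance (M : ModCat K) : Mono (torsionSubmoduleι B M) where
  right_cancellation g h e := by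
    apply ObjectProperty.hom_ext
    ext z m
    exact Subtype.ext congr($(e).hom.app z m)

lemma torsion_map {M N : ModCat K} (hM : Torsion B M) (f : M ⟶ N) {z : K}
    (m : M.obj.obj (op z)) : f.hom.app (op z) m ∈ torsionSubgroup B N z := by
  obtain ⟨z', a, ha, h⟩ := hM z m
  refine ⟨z', a, ha, ?_⟩
  refine (congr($(f.hom.naturality a.op) m)).symm.trans ?_
  change f.hom.app (op z') (M.obj.map a.op m) = 0
  rw [h, map_zero]

/-- A morphism from a torsion module corestricts to the torsion submodule. -/
def torsionLift {M N : ModCat K} (hM : Torsion B M) (f : M ⟶ N) : M ⟶ torsionSubmodule B N :=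
  ObjectProperty.homMk
    { app := fun z => AddCommGrpCat.ofHom
        ((f.hom.app z).hom.codRestrict (torsionSubgroup B N z.unop) fun m => torsion_map hM f m)
      naturality := fun y z g => by
        ext m
        exact Subtype.ext congr($(f.hom.naturality g) m) }

lemma torsionLift_ι {M N : ModCat K} (hM : Torsion B M) (f : M ⟶ N) :
    torsionLift hM f ≫ torsionSubmoduleι B N = f := rfl

lemma hom_app_injective {M N : ModCat K} (f : M ⟶ N) [Mono f] {z : K} {m : M.obj.obj (op z)}
    (hm : f.hom.app (op z) m = 0) : m = 0 := by
  have h : yoHom m = 0 := by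
    rw [← cancel_mono f, zero_comp]
    apply yoElt_injective
    rw [yoElt_comp, yoElt_yoHom, hm]
    rfl
  rw [← yoElt_yoHom m, h]
  rfl

lemma exists_of_exact {S : ShortComplex (ModCat K)} (hS : S.Exact) [Mono S.f] {z : K}
    {m : S.X₂.obj.obj (op z)} (hm : S.g.hom.app (op z) m = 0) :
    ∃ l : S.X₁.obj.obj (op z), S.f.hom.app (op z) l = m := by
  have h : yoHom m ≫ S.g = 0 := by
    apply yoElt_injective
    rw [yoElt_comp, yoElt_yoHom, hm]
    rfl
  refine ⟨yoElt (hS.lift _ h), ?_⟩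
  rw [← yoElt_comp, hS.lift_f, yoElt_yoHom]

lemma hom_app_map {M N : ModCat K} (f : M ⟶ N) {y z : K} (a : y ⟶ z) (m : M.obj.obj (op z)) :
    f.hom.app (op y) (M.obj.map a.op m) = N.obj.map a.op (f.hom.app (op z) m) :=
  congr($(f.hom.naturality a.op) m)

instance : ObjectProperty.IsSerreClass (Torsion B) where
  exists_zero := ⟨0, isZero_zero _, fun z m => ⟨z, 𝟙 z, dense_id B z, by
    have h : yoHom m = 0 := (isZero_zero _).eq_of_tgt _ _
    rw [map_id_apply, ← yoElt_yoHom m, h]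
    rfl⟩⟩
  prop_of_mono f _ hY := fun z m => by
    obtain ⟨z', a, ha, h⟩ := hY z (f.hom.app (op z) m)
    exact ⟨z', a, ha, hom_app_injective f (by rw [hom_app_map, h])⟩
  prop_of_epi f _ hX := fun z m => by
    obtain ⟨l, rfl⟩ := surjective_app_of_epi f (op z) m
    obtain ⟨z', a, ha, h⟩ := hX z l
    exact ⟨z', a, ha, by rw [← hom_app_map, h, map_zero]⟩
  prop_X₂_of_shortExact {S} hS h₁ h₃ := fun z m => by
    have := hS.mono_f
    obtain ⟨y, a, ha, h⟩ := h₃ z (S.g.hom.app (op z) m)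
    rw [← hom_app_map] at h
    obtain ⟨l, hl⟩ := exists_of_exact hS.exact h
    obtain ⟨w, b, hb, h'⟩ := h₁ y l
    refine ⟨w, b ≫ a, hb.comp ha, ?_⟩
    rw [map_comp_apply, ← hl, ← hom_app_map, h', map_zero]

/-- A colimit of torsion modules is torsion: its identity factors through the largest torsion
submodule. -/
instance (J : Type*) [Category* J] :
    ObjectProperty.IsClosedUnderColimitsOfShape (Torsion B) J where
  colimitsOfShape_le := by
    rintro M ⟨h⟩ z m
    let c : Cocone h.diag := ⟨torsionSubmodule B M,
      { app := fun j => torsionLift (h.prop_diag_obj j) (h.ι.app j)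
        naturality := fun i j u => by
          rw [← cancel_mono (torsionSubmoduleι B M), Category.assoc, Category.assoc]
          exact h.ι.naturality u }⟩
    have e : h.isColimit.desc c ≫ torsionSubmoduleι B M = 𝟙 M :=
      h.isColimit.hom_ext fun j => by
        rw [h.isColimit.fac_assoc, Category.comp_id]
        exact torsionLift_ι (h.prop_diag_obj j) _
    have := ((h.isColimit.desc c).hom.app (op z) m).2
    have e' : ((h.isColimit.desc c).hom.app (op z) m).1 = m := congr($(e).hom.app (op z) m)
    rwa [e'] at this

/-- If `h̄_B(f) = 0` then `f` vanishes on a `B`-dense morphism. -/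
lemma exists_dense_comp_eq_zero {x y : K} {f : x ⟶ y} (hf : (residueFunctor B).map f = 0) :
    ∃ (x' : K) (a : x' ⟶ x), Dense B a ∧ a ≫ f = 0 := by
  have hle : generatedLocalizing B ≤ Torsion B := fun M hM =>
    hM (Torsion B) inferInstance (fun _ => inferInstance) (by
      rintro _ ⟨N, hN, ⟨e⟩⟩
      exact ObjectProperty.prop_of_iso _ e (torsion_of_mem hN))
  have him : Torsion B (Abelian.image ((yo K).map f)) := hle _
    ((ObjectProperty.SerreClassLocalization.map_eq_zero_iff
      (generatedLocalizing B).isoModSerre.Q (generatedLocalizing B) ((yo K).map f)).1 hf)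
  obtain ⟨x', a, ha, h⟩ := him x (yoElt (Abelian.factorThruImage ((yo K).map f)))
  refine ⟨x', a, ha, ?_⟩
  have h' := congr_arg ((Abelian.image.ι ((yo K).map f)).hom.app (op x')) h
  rw [hom_app_map, ← yoElt_comp, Abelian.image.fac, map_zero, yoElt_yo_map] at h'
  exact h'

end DenseMorphisms

/-! ### Tensor products with representable modules -/

section TensorIdeals

variable {K : Type u} [Category.{v} K] [MonoidalCategory K] [RigidCategory K]

/-- The counit `(x ⊗ v) ⊗ ᘁv ⟶ x` of the adjunction between `- ⊗ ᘁv` and `- ⊗ v`. -/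
def evalRight (x v : K) : (x ⊗ v) ⊗ (ᘁv) ⟶ x := (tensorRightHomEquiv _ (ᘁv) v _).symm (𝟙 _)

/-- The unit `z ⟶ (z ⊗ ᘁv) ⊗ v` of the adjunction between `- ⊗ ᘁv` and `- ⊗ v`. -/
def coevalRight (z v : K) : z ⟶ (z ⊗ (ᘁv)) ⊗ v := tensorRightHomEquiv _ (ᘁv) v _ (𝟙 _)

lemma whiskerRight_evalRight {z x v : K} (t : z ⟶ x ⊗ v) :
    t ▷ (ᘁv) ≫ evalRight x v = (tensorRightHomEquiv _ (ᘁv) v _).symm t := by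
  rw [evalRight, ← tensorRightHomEquiv_symm_naturality, Category.comp_id]

lemma exists_whiskerRight_evalRight {z x v : K} (s : z ⊗ (ᘁv) ⟶ x) :
    ∃ t : z ⟶ x ⊗ v, t ▷ (ᘁv) ≫ evalRight x v = s :=
  ⟨tensorRightHomEquiv _ (ᘁv) v _ s, by rw [whiskerRight_evalRight, Equiv.symm_apply_apply]⟩

lemma whiskerRight_evalRight_injective {z x v : K} {s t : z ⟶ x ⊗ v}
    (h : s ▷ (ᘁv) ≫ evalRight x v = t ▷ (ᘁv) ≫ evalRight x v) : s = t := by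
  rwa [whiskerRight_evalRight, whiskerRight_evalRight, Equiv.apply_eq_iff_eq] at h

lemma coevalRight_evalRight (z v : K) :
    coevalRight z v ▷ (ᘁv) ≫ evalRight (z ⊗ (ᘁv)) v = 𝟙 _ := by
  rw [whiskerRight_evalRight, coevalRight, Equiv.symm_apply_apply]

lemma evalRight_naturality {x y : K} (a : y ⟶ x) (v : K) :
    (a ▷ v) ▷ (ᘁv) ≫ evalRight x v = evalRight y v ≫ a := by
  rw [whiskerRight_evalRight, Equiv.symm_apply_eq, tensorRightHomEquiv_naturality, evalRight,
    Equiv.apply_symm_apply, Category.id_comp]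

lemma coevalRight_naturality {z z' : K} (g : z' ⟶ z) (v : K) :
    coevalRight z' v ≫ (g ▷ (ᘁv)) ▷ v = g ≫ coevalRight z v := by
  apply whiskerRight_evalRight_injective
  rw [comp_whiskerRight, Category.assoc, evalRight_naturality, reassoc_of% coevalRight_evalRight,
    comp_whiskerRight, Category.assoc, coevalRight_evalRight, Category.comp_id]

lemma coevalRight_whiskerRight_evalRight (a v : K) :
    coevalRight (a ⊗ v) v ≫ evalRight a v ▷ v = 𝟙 _ := by
  apply whiskerRight_evalRight_injective
  rw [comp_whiskerRight, Category.assoc, evalRight_naturality, reassoc_of% coevalRight_evalRight,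
    id_whiskerRight, Category.id_comp]

variable [Preadditive K] [MonoidalPreadditive K]

/-- The module `M ⊗ v̂`, described as `z ↦ M(z ⊗ ᘁv)` by rigidity of `v`. -/
def twist (v : K) (M : ModCat K) : ModCat K :=
  ⟨(tensorRight (ᘁv)).op ⋙ M.obj, ⟨fun {x y f g} => by
    ext m
    refine Eq.trans ?_ (map_add_apply M (f.unop ▷ (ᘁv)) (g.unop ▷ (ᘁv)) m)
    rw [← MonoidalPreadditive.add_whiskerRight]
    rfl⟩⟩

lemma fp_twist {M : ModCat K} (hM : fp K M) (v : K) : fp K (twist v M) := by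
  obtain ⟨y, x, a, p, hap, hp, h⟩ := fp_elements hM
  let p' : (twist v M).obj.obj (op (x ⊗ v)) := M.obj.map (evalRight x v).op p
  have key : ∀ (z : K) (t : z ⟶ x ⊗ v), (twist v M).obj.map t.op p' =
      M.obj.map (t ▷ (ᘁv) ≫ evalRight x v).op p := fun z t => (map_comp_apply M _ _ p).symm
  rw [fp_iff]
  refine ⟨y ⊗ v, x ⊗ v, a ▷ v, yoHom p', ?_, fun z t => ?_, fun z t ht => ?_⟩
  · apply yoElt_injective
    rw [yoElt_map_comp, yoElt_yoHom, key, evalRight_naturality, map_comp_apply, hap, map_zero]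
    rfl
  · let e := yoElt t
    obtain ⟨s, hs⟩ := hp (z ⊗ (ᘁv)) e
    obtain ⟨s', rfl⟩ := exists_whiskerRight_evalRight s
    refine ⟨s', yoElt_injective ?_⟩
    rw [yoElt_map_comp, yoElt_yoHom, key, hs]
  · have ht' := congr_arg yoElt ht
    rw [yoElt_map_comp, yoElt_yoHom, key] at ht'
    obtain ⟨r, hr⟩ := h _ _ ht'
    obtain ⟨r', rfl⟩ := exists_whiskerRight_evalRight r
    refine ⟨r', whiskerRight_evalRight_injective ?_⟩
    rw [comp_whiskerRight, Category.assoc, evalRight_naturality, ← hr, Category.assoc]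

/-- The finitely presented module `M ⊗ v̂`, `z ↦ M(z ⊗ ᘁv)`. -/
def twistFP (v : K) (M : FPMod K) : FPMod K := ⟨twist v M.obj, fp_twist M.property v⟩

variable [HasZeroObject K] [HasBinaryBiproducts K] [HasWeakKernels K]

lemma twistPairing_add (M : ModCat K) {x y v : K} (n n' : y ⟶ v) (m : M.obj.obj (op x)) :
    M.obj.map ((x ◁ (n + n')) ▷ (ᘁv) ≫ evalRight x v).op m =
      M.obj.map ((x ◁ n) ▷ (ᘁv) ≫ evalRight x v).op m +
        M.obj.map ((x ◁ n') ▷ (ᘁv) ≫ evalRight x v).op m := by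
  rw [← map_add_apply, MonoidalPreadditive.whiskerLeft_add,
    MonoidalPreadditive.add_whiskerRight, Preadditive.add_comp]

lemma twistPairing_naturality (M : ModCat K) {x x' y y' v : K} (f : x' ⟶ x) (g : y' ⟶ y)
    (n : y ⟶ v) (m : M.obj.obj (op x)) :
    M.obj.map ((x' ◁ (g ≫ n)) ▷ (ᘁv) ≫ evalRight x' v).op (M.obj.map f.op m) =
      M.obj.map ((f ⊗ₘ g) ▷ (ᘁv)).op (M.obj.map ((x ◁ n) ▷ (ᘁv) ≫ evalRight x v).op m) := by
  rw [← map_comp_apply, ← map_comp_apply, Category.assoc, ← evalRight_naturality,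
    ← comp_whiskerRight_assoc, ← comp_whiskerRight_assoc, MonoidalCategory.tensorHom_def,
    MonoidalCategory.whiskerLeft_comp, Category.assoc, whisker_exchange, whisker_exchange_assoc,
    Category.assoc]

/-- The canonical pairing `M(x) × Hom(y, v) ⟶ M((x ⊗ y) ⊗ ᘁv)`. -/
def twistPairing (v : K) (M : FPMod K) :
    BiadditivePairing M.obj ((yoFP K).obj v).obj (twistFP v M).obj where
  app x y := AddMonoidHom.mk' (fun m => AddMonoidHom.mk'
      (fun n : y ⟶ v => M.obj.obj.map ((x ◁ n) ▷ (ᘁv) ≫ evalRight x v).op m) (fun n n' => by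
        exact twistPairing_add M.obj n n' m))
    (fun m m' => by
      ext n
      exact (M.obj.obj.map ((x ◁ (show y ⟶ v from n)) ▷ (ᘁv) ≫ evalRight x v).op).hom.map_add m m')
  naturality f g m n := twistPairing_naturality M.obj f g n m

/-- The Day convolution product `M ⊗ v̂` maps onto `twistFP v M`. -/
lemma exists_epi_tensorFP_twistFP (v : K) (M : FPMod K) :
    ∃ u : tensorFP M ((yoFP K).obj v) ⟶ twistFP v M, Epi u := by
  obtain ⟨u, hu, -⟩ := tensorFPPairing_isUniversal M ((yoFP K).obj v) _ (twistPairing v M)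
  refine ⟨ObjectProperty.homMk u, fp_epi_of_surjective _ fun z m => ?_⟩
  let n := (tensorFPPairing M ((yoFP K).obj v)).app (z ⊗ (ᘁv)) v m (𝟙 v)
  refine ⟨(tensorFP M ((yoFP K).obj v)).obj.obj.map (coevalRight z v).op n, ?_⟩
  refine (hom_app_map u (coevalRight z v) n).trans ?_
  have hn : u.hom.app _ n = (twistPairing v M).app (z ⊗ (ᘁv)) v m (𝟙 v) := by
    rw [← hu]; rfl
  rw [hn]
  have key (m : M.obj.obj.obj (op (z ⊗ (ᘁv)))) : M.obj.obj.map (coevalRight z v ▷ (ᘁv)).op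
      (M.obj.obj.map (((z ⊗ (ᘁv)) ◁ 𝟙 v) ▷ (ᘁv) ≫ evalRight (z ⊗ (ᘁv)) v).op m) = m := by
    rw [← map_comp_apply, MonoidalCategory.whiskerLeft_id, id_whiskerRight, Category.id_comp,
      coevalRight_evalRight, map_id_apply]
  exact key m

/-- The target of a universal pairing is generated by the values of the pairing. -/
lemma BiadditivePairing.IsUniversal.epi {M N T : FPMod K}
    {φ : BiadditivePairing M.obj N.obj T.obj} (hφ : φ.IsUniversal) {S : FPMod K} (u : S ⟶ T)
    (h : ∀ (x y : K) (m : M.obj.obj.obj (op x)) (n : N.obj.obj.obj (op y)),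
      ∃ s, u.hom.hom.app (op (x ⊗ y)) s = φ.app x y m n) : Epi u where
  left_cancellation {T'} g₁ g₂ hg := by
    apply ObjectProperty.hom_ext
    refine (hφ T'.obj (φ.postcomp g₂.hom)).unique ?_ rfl
    apply BiadditivePairing.ext
    ext x y m n
    obtain ⟨s, hs⟩ := h x y m n
    change g₁.hom.hom.app _ (φ.app x y m n) = g₂.hom.hom.app _ (φ.app x y m n)
    rw [← hs]
    exact congr($(hg).hom.hom.app _ s)

/-- If `v̂` covers `N`, then `twistFP v M` maps onto the Day convolution product `M ⊗ N`. -/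
lemma exists_epi_twistFP_tensorFP (M N : FPMod K) :
    ∃ (v : K) (u : twistFP v M ⟶ tensorFP M N), Epi u := by
  obtain ⟨_, v, -, q, -, hq, -⟩ := fp_elements N.property
  let φ := tensorFPPairing M N
  let T := tensorFP M N
  let u : twistFP v M ⟶ T := ObjectProperty.homMk (ObjectProperty.homMk
    { app := fun z => AddCommGrpCat.ofHom (AddMonoidHom.mk'
        (fun m : M.obj.obj.obj (op (z.unop ⊗ (ᘁv))) =>
          T.obj.obj.map (coevalRight z.unop v).op (φ.app _ v m q)) (fun m m' => by
            rw [map_add, AddMonoidHom.add_apply, map_add]))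
      naturality := fun z z' g => by
        ext m
        change T.obj.obj.map (coevalRight z'.unop v).op
          (φ.app _ v (M.obj.obj.map (g.unop ▷ (ᘁv)).op m) q) =
            T.obj.obj.map g.unop.op (T.obj.obj.map (coevalRight z.unop v).op (φ.app _ v m q))
        have e := φ.naturality (g.unop ▷ (ᘁv)) (𝟙 v) m q
        rw [map_id_apply] at e
        rw [e, ← map_comp_apply, ← map_comp_apply, tensorHom_id, coevalRight_naturality]
        rfl })
  refine ⟨v, u, (tensorFPPairing_isUniversal M N).epi u fun x y m n => ?_⟩
  obtain ⟨s, rfl⟩ := hq y n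
  let m' : (twistFP v M).obj.obj.obj (op (x ⊗ v)) := M.obj.obj.map (evalRight x v).op m
  have hm' : u.hom.hom.app _ m' = φ.app x v m q := by
    change T.obj.obj.map (coevalRight (x ⊗ v) v).op
      (φ.app _ v (M.obj.obj.map (evalRight x v).op m) q) = _
    have e := φ.naturality (evalRight x v) (𝟙 v) m q
    rw [map_id_apply] at e
    rw [e, ← map_comp_apply, tensorHom_id, coevalRight_whiskerRight_evalRight, map_id_apply]
  refine ⟨(twistFP v M).obj.obj.map (x ◁ s).op m', ?_⟩
  rw [hom_app_map, hm']
  have e := φ.naturality (𝟙 x) s m q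
  rw [map_id_apply, id_tensorHom] at e
  exact e.symm

/-- A Serre subcategory of `mod-K` is a `⊗`-ideal as soon as it is stable under tensoring with
representable modules. -/
lemma isSerreTensorIdeal_iff (B : ObjectProperty (FPMod K)) :
    IsSerreTensorIdeal B ↔ B.IsSerreClass ∧ ∀ (v : K) (M : FPMod K), B M → B (twistFP v M) := by
  constructor
  · rintro ⟨h, h'⟩
    refine ⟨h, fun v M hM => ?_⟩
    obtain ⟨u, hu⟩ := exists_epi_tensorFP_twistFP v M
    exact B.prop_of_epi u (h' _ _ hM)
  · rintro ⟨h, h'⟩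
    refine ⟨h, fun M N hM => ?_⟩
    obtain ⟨v, u, hu⟩ := exists_epi_twistFP_tensorFP M N
    exact B.prop_of_epi u (h' _ _ hM)

lemma IsSerreTensorIdeal.twistFP_mem {B : ObjectProperty (FPMod K)} (hB : IsSerreTensorIdeal B)
    {M : FPMod K} (hM : B M) (v : K) : B (twistFP v M) :=
  ((isSerreTensorIdeal_iff B).1 hB).2 v M hM

lemma Dense.whiskerRight {B : ObjectProperty (FPMod K)} (hB : IsSerreTensorIdeal B) {x y : K}
    {a : y ⟶ x} (ha : Dense B a) (v : K) : Dense B (a ▷ v) := by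
  obtain ⟨M, hM, m, hm⟩ := ha
  refine ⟨twistFP v M, hB.twistFP_mem hM v, M.obj.obj.map (evalRight x v).op m, fun z t ht => ?_⟩
  change M.obj.obj.map (t ▷ (ᘁv)).op (M.obj.obj.map (evalRight x v).op m) = 0 at ht
  rw [← map_comp_apply] at ht
  obtain ⟨r, hr⟩ := hm _ _ ht
  obtain ⟨r', rfl⟩ := exists_whiskerRight_evalRight r
  refine ⟨r', whiskerRight_evalRight_injective ?_⟩
  rw [comp_whiskerRight, Category.assoc, evalRight_naturality, ← hr, Category.assoc]

end TensorIdeals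

/-! ### Homological primes -/

section HomologicalPrimes

variable {K : Type u} [Category.{v} K] [Preadditive K] [MonoidalCategory K] [MonoidalPreadditive K]
  [RigidCategory K] [SymmetricCategory K] [HasZeroObject K] [HasBinaryBiproducts K]
  [HasWeakKernels K]

/-- The ideal quotient `(B : v̂)` of the modules `M` such that `M ⊗ v̂` belongs to `B`. -/
def colon (B : ObjectProperty (FPMod K)) (v : K) : ObjectProperty (FPMod K) :=
  fun M => B (twistFP v M)

lemma colon_iff (B : ObjectProperty (FPMod K)) [B.IsSerreClass] (v : K) (M : FPMod K) :
    colon B v M ↔ ∀ (z : K) (m : M.obj.obj.obj (op (z ⊗ (ᘁv)))), ∃ (z' : K) (a : z' ⟶ z),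
      Dense B a ∧ M.obj.obj.map (a ▷ (ᘁv)).op m = 0 :=
  mem_iff_torsion (twistFP v M)

instance (B : ObjectProperty (FPMod K)) [B.IsSerreClass] (v : K) :
    (colon B v).IsSerreClass where
  exists_zero := by
    refine ⟨0, isZero_zero _, (colon_iff B v _).2 fun z m => ⟨z, 𝟙 z, dense_id B z, ?_⟩⟩
    rw [← fpHom_eq_zero_iff]
    exact (isZero_zero _).eq_of_tgt _ _
  prop_of_mono {M N} f _ hN := by
    rw [colon_iff] at hN ⊢
    intro z m
    obtain ⟨z', a, ha, h⟩ := hN z (f.hom.hom.app _ m)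
    exact ⟨z', a, ha, fp_injective_of_mono f ((hom_app_map f.hom _ m).trans h)⟩
  prop_of_epi {M N} f _ hM := by
    rw [colon_iff] at hM ⊢
    intro z m
    obtain ⟨l, rfl⟩ := fp_surjective_of_epi f _ m
    obtain ⟨z', a, ha, h⟩ := hM z l
    exact ⟨z', a, ha, by rw [← hom_app_map, h, map_zero]⟩
  prop_X₂_of_shortExact {S} hS h₁ h₃ := by
    have := hS.mono_f
    rw [colon_iff] at h₁ h₃ ⊢
    intro z m
    obtain ⟨y, a, ha, h⟩ := h₃ z (S.g.hom.hom.app _ m)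
    rw [← hom_app_map] at h
    obtain ⟨l, hl⟩ := fp_exists_of_exact hS.exact h
    obtain ⟨w, b, hb, h'⟩ := h₁ y l
    refine ⟨w, b ≫ a, hb.comp ha, ?_⟩
    rw [comp_whiskerRight, map_comp_apply, ← hl, ← hom_app_map, h', map_zero]

/-- The isomorphism `(z ⊗ p) ⊗ q ≅ (z ⊗ q) ⊗ p`. -/
def swapRight (z p q : K) : (z ⊗ p) ⊗ q ≅ (z ⊗ q) ⊗ p :=
  α_ z p q ≪≫ whiskerLeftIso z (β_ p q) ≪≫ (α_ z q p).symm

lemma swapRight_naturality {z z' : K} (a : z' ⟶ z) (p q : K) :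
    (a ▷ p) ▷ q ≫ (swapRight z p q).hom = (swapRight z' p q).hom ≫ (a ▷ q) ▷ p := by
  simp only [swapRight, Iso.trans_hom, Iso.symm_hom, whiskerLeftIso_hom]
  rw [associator_naturality_left_assoc, ← whisker_exchange_assoc, associator_inv_naturality_left,
    Category.assoc, Category.assoc]

lemma IsSerreTensorIdeal.colon {B : ObjectProperty (FPMod K)} (hB : IsSerreTensorIdeal B) (v : K) :
    IsSerreTensorIdeal (colon B v) := by
  have := hB.isSerreClass
  refine (isSerreTensorIdeal_iff _).2 ⟨inferInstance, fun w M hM => ?_⟩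
  rw [colon_iff]
  intro z (m : M.obj.obj.obj (op ((z ⊗ (ᘁv)) ⊗ (ᘁw))))
  obtain ⟨z', a, ha, h⟩ := torsion_of_mem (hB.twistFP_mem hM w) z
    (M.obj.obj.map (swapRight z (ᘁv) (ᘁw)).inv.op m)
  have h : M.obj.obj.map ((a ▷ (ᘁw)) ▷ (ᘁv)).op
    (M.obj.obj.map (swapRight z (ᘁv) (ᘁw)).inv.op m) = 0 := h
  refine ⟨z', a, ha, ?_⟩
  change M.obj.obj.map ((a ▷ (ᘁv)) ▷ (ᘁw)).op m = 0
  have e : (a ▷ (ᘁv)) ▷ (ᘁw) = (swapRight z' (ᘁv) (ᘁw)).hom ≫ (a ▷ (ᘁw)) ▷ (ᘁv) ≫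
      (swapRight z (ᘁv) (ᘁw)).inv := by
    rw [← Category.assoc, ← swapRight_naturality, Category.assoc, Iso.hom_inv_id, Category.comp_id]
  rw [e, map_comp_apply, map_comp_apply, h, map_zero]

lemma IsSerreTensorIdeal.le_colon {B : ObjectProperty (FPMod K)} (hB : IsSerreTensorIdeal B)
    (v : K) : B ≤ TTGeom.colon B v :=
  fun _ hM => hB.twistFP_mem hM v

lemma colon_yoFP_iff {B : ObjectProperty (FPMod K)} [B.IsSerreClass] (x v : K) :
    colon B v ((yoFP K).obj x) ↔ B ((yoFP K).obj (x ⊗ v)) := by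
  rw [colon_iff, mem_iff_torsion (B := B)]
  constructor
  · intro h z (t : z ⟶ x ⊗ v)
    obtain ⟨z', a, ha, h'⟩ := h z (t ▷ (ᘁv) ≫ evalRight x v)
    have h' : a ▷ (ᘁv) ≫ t ▷ (ᘁv) ≫ evalRight x v = 0 := h'
    refine ⟨z', a, ha, whiskerRight_evalRight_injective (s := a ≫ t) (t := (0 : z' ⟶ x ⊗ v)) ?_⟩
    rw [comp_whiskerRight, Category.assoc, h', MonoidalPreadditive.zero_whiskerRight, zero_comp]
  · intro h z (s : z ⊗ (ᘁv) ⟶ x)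
    obtain ⟨t, rfl⟩ := exists_whiskerRight_evalRight s
    obtain ⟨z', a, ha, h'⟩ := h z t
    have h' : a ≫ t = 0 := h'
    refine ⟨z', a, ha, ?_⟩
    change a ▷ (ᘁv) ≫ t ▷ (ᘁv) ≫ evalRight x v = 0
    rw [← comp_whiskerRight_assoc, h', MonoidalPreadditive.zero_whiskerRight, zero_comp]

variable {B : ObjectProperty (FPMod K)}

lemma IsSerreTensorIdeal.mem_of_iso (hB : IsSerreTensorIdeal B) {x y : K} (e : x ≅ y)
    (hx : B ((yoFP K).obj x)) : B ((yoFP K).obj y) := by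
  have := hB.isSerreClass
  exact B.prop_of_iso ((yoFP K).mapIso e) hx

lemma IsSerreTensorIdeal.mem_tensor (hB : IsSerreTensorIdeal B) {x : K}
    (hx : B ((yoFP K).obj x)) (v : K) : B ((yoFP K).obj (x ⊗ v)) := by
  have := hB.isSerreClass
  exact (colon_yoFP_iff x v).1 (hB.le_colon v _ hx)

/-- A Serre `⊗`-ideal that contains the unit contains everything. -/
lemma IsSerreTensorIdeal.eq_top (hB : IsSerreTensorIdeal B) (h : B ((yoFP K).obj (𝟙_ K))) :
    B = ⊤ := by
  have := hB.isSerreClass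
  rw [eq_top_iff]
  intro M _
  refine mem_of_torsion fun z m => ⟨z, 0, ?_, map_zero_apply _ _⟩
  exact (mem_yoFP_iff z).1 (hB.mem_of_iso (λ_ z) (hB.mem_tensor h z))

/-- Serre `⊗`-ideals are radical on objects of `K`, as `x` is a direct summand of
`(x ⊗ x) ⊗ ᘁx`. -/
lemma IsSerreTensorIdeal.mem_of_mem_tensor_self (hB : IsSerreTensorIdeal B) {x : K}
    (hx : B ((yoFP K).obj (x ⊗ x))) : B ((yoFP K).obj x) := by
  have := hB.isSerreClass
  have h : B ((yoFP K).obj (((𝟙_ K ⊗ x) ⊗ (ᘁx)) ⊗ x)) :=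
    hB.mem_of_iso (swapRight x x (ᘁx) ≪≫
      whiskerRightIso (whiskerRightIso (λ_ x).symm (ᘁx)) x) (hB.mem_tensor hx (ᘁx))
  exact hB.mem_of_iso (λ_ x) (mem_yoFP_of_retract _ _
    (coevalRight_whiskerRight_evalRight (𝟙_ K) x) h)

/-- The cokernel of the evaluation `x ⊗ ᘁx ⟶ 𝟙` is annihilated by `x̂`. -/
lemma colon_cokernel_evalRight [B.IsSerreClass] (x : K) :
    colon B x (cokernel ((yoFP K).map (evalRight (𝟙_ K) x))) := by
  rw [colon_iff]
  intro z m
  refine ⟨z, 𝟙 z, dense_id B z, ?_⟩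
  obtain ⟨t, ht⟩ := surjective_cokernel_π _ m
  obtain ⟨t', rfl⟩ := exists_whiskerRight_evalRight t
  have hm : m = 0 := by
    rw [← fpHom_eq_zero_iff, ht, Functor.map_comp, Category.assoc, cokernel.condition, comp_zero]
  rw [hm, map_zero]

/-- Serre `⊗`-ideals that are maximal among those avoiding a `⊗`-multiplicative class of objects of
`K` are homological primes. -/
lemma exists_homologicalPrime (hB : IsSerreTensorIdeal B) (S : ObjectProperty K) (h₁ : S (𝟙_ K))
    (hmul : ∀ s t, S s → S t → S (s ⊗ t)) (hBS : ∀ s, S s → ¬ B ((yoFP K).obj s)) :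
    ∃ H : HomologicalPrime K, B ≤ H.carrier ∧ ∀ s, S s → ¬ H.carrier ((yoFP K).obj s) := by
  obtain ⟨H, hBH, hH⟩ := zorn_le_nonempty₀
    {C : ObjectProperty (FPMod K) | IsSerreTensorIdeal C ∧ ∀ s, S s → ¬ C ((yoFP K).obj s)}
    (fun c hc hchain D hD => by
      refine ⟨fun M => ∃ C ∈ c, C M, ⟨⟨?_, ?_⟩, ?_⟩, fun C hC M hM => ⟨C, hC, hM⟩⟩
      · have hS : ∀ C ∈ c, C.IsSerreClass := fun C hC => (hc hC).1.isSerreClass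
        exact
          { exists_zero := by
              have := hS D hD
              obtain ⟨Z, hZ, hZ'⟩ := D.exists_prop_of_containsZero
              exact ⟨Z, hZ, D, hD, hZ'⟩
            prop_of_mono := by
              rintro M N f _ ⟨C, hC, hN⟩
              have := hS C hC
              exact ⟨C, hC, C.prop_of_mono f hN⟩
            prop_of_epi := by
              rintro M N f _ ⟨C, hC, hM⟩
              have := hS C hC
              exact ⟨C, hC, C.prop_of_epi f hM⟩
            prop_X₂_of_shortExact := by
              rintro T hT ⟨C, hC, hM⟩ ⟨C', hC', hM'⟩
              have := hS C hC
              have := hS C' hC'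
              rcases hchain.total hC hC' with h | h
              · exact ⟨C', hC', C'.prop_X₂_of_shortExact hT (h _ hM) hM'⟩
              · exact ⟨C, hC, C.prop_X₂_of_shortExact hT hM (h _ hM')⟩ }
      · rintro M N ⟨C, hC, hM⟩
        exact ⟨C, hC, (hc hC).1.tensor_mem M N hM⟩
      · rintro s hs ⟨C, hC, hs'⟩
        exact (hc hC).2 s hs hs')
    B ⟨hB, hBS⟩
  have hHI : IsSerreTensorIdeal H := hH.prop.1
  have hHS := hH.prop.2
  have := hHI.isSerreClass
  refine ⟨⟨H, hHI, ?_, fun C hC hHC hne => ?_⟩, hBH, hHS⟩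
  · rintro rfl
    exact hHS _ h₁ trivial
  · by_contra hCH
    obtain ⟨s, hs, hCs⟩ : ∃ s, S s ∧ C ((yoFP K).obj s) := by
      by_contra! hCS
      exact hCH (le_antisymm (hH.le_of_ge ⟨hC, hCS⟩ hHC) hHC)
    have hcolon : TTGeom.colon H s ≤ H := hH.le_of_ge
      ⟨hHI.colon s, fun t ht => by rw [colon_yoFP_iff]; exact hHS _ (hmul t s ht hs)⟩
      (hHI.le_colon s)
    -- The cokernel of `s ⊗ ᘁs ⟶ 𝟙` lies in `H`, its source in `C`, hence `𝟙` lies in `C`.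
    have hε : Dense H (evalRight (𝟙_ K) s) :=
      dense_of_cokernel_mem (hcolon _ (colon_cokernel_evalRight s))
    have hC' := hC.isSerreClass
    have h0 := ((mem_yoFP_iff _).1 (hC.mem_tensor (hC.mem_of_iso (λ_ s).symm hCs) (ᘁs))).comp
      (hε.mono hHC)
    rw [zero_comp] at h0
    exact hne (hC.eq_top (mem_yoFP_of_dense_zero h0))

/-- Primality follows by comparing a homological prime `B` with the larger ideal `(B : ŷ)`. -/
lemma HomologicalPrime.prime (H : HomologicalPrime K) {x y : K}
    (hxy : H.carrier ((yoFP K).obj (x ⊗ y))) :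
    H.carrier ((yoFP K).obj x) ∨ H.carrier ((yoFP K).obj y) := by
  have hH := H.isSerreTensorIdeal
  have := hH.isSerreClass
  by_contra! h
  have hc := H.maximal (colon H.carrier y) (hH.colon y) (hH.le_colon y) (fun htop => h.2 (by
    have : colon H.carrier y ((yoFP K).obj (𝟙_ K)) := by rw [htop]; trivial
    exact hH.mem_of_iso (λ_ y) ((colon_yoFP_iff _ _).1 this)))
  exact h.1 (by rw [← hc, colon_yoFP_iff]; exact hxy)

end HomologicalPrimes

/-! ### Tensor-nilpotence -/

section Nilpotence

section

variable {C : Type u} [Category.{v} C] [MonoidalCategory C]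

lemma tensorPowMap_add {x y : C} (f : x ⟶ y) (m n : ℕ) :
    ∃ (e : tensorPow x (m + n) ⟶ tensorPow x m ⊗ tensorPow x n)
      (e' : tensorPow y m ⊗ tensorPow y n ⟶ tensorPow y (m + n)),
      tensorPowMap f (m + n) = e ≫ (tensorPowMap f m ⊗ₘ tensorPowMap f n) ≫ e' := by
  induction n with
  | zero => exact ⟨(ρ_ _).inv, (ρ_ _).hom, by
    change tensorPowMap f m = (ρ_ _).inv ≫ (tensorPowMap f m ⊗ₘ 𝟙 (𝟙_ C)) ≫ (ρ_ _).hom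
    rw [tensorHom_id, rightUnitor_naturality, Iso.inv_hom_id_assoc]⟩
  | succ n ih =>
    obtain ⟨e, e', h⟩ := ih
    refine ⟨e ▷ x ≫ (α_ _ _ _).hom, (α_ _ _ _).inv ≫ e' ▷ y, ?_⟩
    change tensorPowMap f (m + n) ⊗ₘ f = (e ▷ x ≫ (α_ _ _ _).hom) ≫
      (tensorPowMap f m ⊗ₘ (tensorPowMap f n ⊗ₘ f)) ≫ (α_ _ _ _).inv ≫ e' ▷ y
    rw [h, Category.assoc, ← associator_naturality_assoc, Iso.hom_inv_id_assoc]
    rw [← tensorHom_id, ← tensorHom_id, tensorHom_comp_tensorHom, tensorHom_comp_tensorHom,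
      Category.id_comp, Category.comp_id]

lemma tensorPow_unit_iso {C : Type*} [Category* C] [MonoidalCategory C] (n : ℕ) :
    Nonempty (tensorPow (𝟙_ C) n ≅ 𝟙_ C) := by
  induction n with
  | zero => exact ⟨Iso.refl _⟩
  | succ n ih => exact ⟨ρ_ _ ≪≫ ih.some⟩

end

variable {K : Type u} [Category.{v} K] [Preadditive K] [MonoidalCategory K]

/-- The morphism `g : a ⟶ c` kills the module `M` if `M(g ⊗ u) = 0` for all `u`. If `c` is rigid
this says that `g ⊗ M : â ⊗ M ⟶ ĉ ⊗ M` vanishes. -/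
def Kills {a c : K} (g : a ⟶ c) (M : ModCat K) : Prop :=
  ∀ (u : K) (m : M.obj.obj (op (c ⊗ u))), M.obj.map (g ▷ u).op m = 0

lemma Kills.comp_comp {a a' c c' : K} {g : a ⟶ c} {M : ModCat K} (h : Kills g M) (e : a' ⟶ a)
    (e' : c ⟶ c') : Kills (e ≫ g ≫ e') M := by
  intro u m
  rw [comp_whiskerRight, comp_whiskerRight, map_comp_apply, map_comp_apply, h, map_zero]

variable [SymmetricCategory K]

/-- The isomorphism `p ⊗ (q ⊗ u) ≅ q ⊗ (p ⊗ u)`. -/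
def swapLeft (p q u : K) : p ⊗ (q ⊗ u) ≅ q ⊗ (p ⊗ u) :=
  (α_ p q u).symm ≪≫ whiskerRightIso (β_ p q) u ≪≫ α_ q p u

lemma swapLeft_naturality {a c : K} (g : a ⟶ c) (p u : K) :
    p ◁ (g ▷ u) ≫ (swapLeft p c u).hom = (swapLeft p a u).hom ≫ g ▷ (p ⊗ u) := by
  simp only [swapLeft, Iso.trans_hom, Iso.symm_hom, whiskerRightIso_hom]
  rw [associator_inv_naturality_middle_assoc, ← comp_whiskerRight_assoc,
    BraidedCategory.braiding_naturality_right, comp_whiskerRight_assoc,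
    associator_naturality_left, Category.assoc, Category.assoc]

lemma Kills.whiskerLeft {a c : K} {g : a ⟶ c} {M : ModCat K} (h : Kills g M) (p u : K)
    (m : M.obj.obj (op (p ⊗ (c ⊗ u)))) : M.obj.map (p ◁ (g ▷ u)).op m = 0 := by
  have e : p ◁ (g ▷ u) = (swapLeft p a u).hom ≫ g ▷ (p ⊗ u) ≫ (swapLeft p c u).inv := by
    rw [← Category.assoc, ← swapLeft_naturality, Category.assoc, Iso.hom_inv_id, Category.comp_id]
  rw [e, map_comp_apply, map_comp_apply, h, map_zero]

variable [RigidCategory K]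

lemma Kills.twist [MonoidalPreadditive K] {a c : K} {g : a ⟶ c} {M : ModCat K} (h : Kills g M)
    (v : K) : Kills g (twist v M) := by
  intro u (m : M.obj.obj (op ((c ⊗ u) ⊗ (ᘁv))))
  change M.obj.map ((g ▷ u) ▷ (ᘁv)).op m = 0
  have e : (g ▷ u) ▷ (ᘁv) = (α_ _ _ _).hom ≫ g ▷ (u ⊗ (ᘁv)) ≫ (α_ _ _ _).inv := by simp
  rw [e, map_comp_apply, map_comp_apply, h, map_zero]

variable [HasZeroObject K] [HasBinaryBiproducts K] [HasWeakKernels K]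

/-- If `g` kills a submodule and `h` kills the quotient, then `h ⊗ g` kills the module. -/
lemma Kills.tensorHom_of_shortExact {S : ShortComplex (FPMod K)} (hS : S.ShortExact)
    {a c a' c' : K} {h : a' ⟶ c'} {g : a ⟶ c} (h₁ : Kills g S.X₁.obj) (h₃ : Kills h S.X₃.obj) :
    Kills (h ⊗ₘ g) S.X₂.obj := by
  have := hS.mono_f
  intro u m
  have e : (h ⊗ₘ g) ▷ u = (α_ _ _ _).hom ≫ a' ◁ (g ▷ u) ≫ h ▷ (c ⊗ u) ≫ (α_ _ _ _).inv := by
    rw [tensorHom_def']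
    simp
  rw [e, map_comp_apply, map_comp_apply, map_comp_apply]
  have hm := h₃ (c ⊗ u) (S.g.hom.hom.app _ (S.X₂.obj.obj.map (α_ _ _ _).inv.op m))
  rw [← hom_app_map] at hm
  obtain ⟨l, hl⟩ := fp_exists_of_exact hS.exact hm
  rw [← hl, ← hom_app_map, h₁.whiskerLeft, map_zero, map_zero]

variable [MonoidalPreadditive K]

lemma whiskerRight_eq_zero_of_kills {a c z : K} {g : a ⟶ c} (h : Kills g ((yo K).obj z)) :
    g ▷ z = 0 := by
  have e : ∀ t : a ⊗ z ⟶ c ⊗ z, (tensorLeftHomEquiv (a ⊗ z) c (cᘁ) z).symm t =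
      (cᘁ) ◁ t ≫ (tensorLeftHomEquiv (c ⊗ z) c (cᘁ) z).symm (𝟙 _) := fun t => by
    rw [← tensorLeftHomEquiv_symm_naturality, Category.comp_id]
  apply (tensorLeftHomEquiv (a ⊗ z) c (cᘁ) z).symm.injective
  rw [e, e, MonoidalPreadditive.whiskerLeft_zero, zero_comp]
  exact h.whiskerLeft (cᘁ) z ((tensorLeftHomEquiv (c ⊗ z) c (cᘁ) z).symm (𝟙 _))

lemma kills_yo_of_whiskerRight_eq_zero {a z : K} {g : a ⟶ 𝟙_ K} (h : g ▷ z = 0) :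
    Kills g ((yo K).obj z) := by
  intro u (t : 𝟙_ K ⊗ u ⟶ z)
  change g ▷ u ≫ t = 0
  have e : t = 𝟙_ K ◁ ((λ_ u).inv ≫ t) ≫ (λ_ z).hom := by
    rw [leftUnitor_naturality, Iso.hom_inv_id_assoc]
  rw [e, ← whisker_exchange_assoc, h, zero_comp, comp_zero]

/-- The Serre `⊗`-ideal of the finitely presented modules on which `f` is `⊗`-nilpotent. -/
def nilIdeal {x y : K} (f : x ⟶ y) : ObjectProperty (FPMod K) :=
  fun M => ∃ n : ℕ, 1 ≤ n ∧ Kills (tensorPowMap f n) M.obj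

lemma isSerreTensorIdeal_nilIdeal {x y : K} (f : x ⟶ y) : IsSerreTensorIdeal (nilIdeal f) := by
  refine (isSerreTensorIdeal_iff _).2 ⟨?_, ?_⟩
  · exact
      { exists_zero := ⟨0, isZero_zero _, 1, le_rfl, fun u m => by
          rw [← fpHom_eq_zero_iff]
          exact (isZero_zero (FPMod K)).eq_of_tgt _ _⟩
        prop_of_mono := by
          rintro M N i _ ⟨n, hn, h⟩
          refine ⟨n, hn, fun u m => fp_injective_of_mono i ?_⟩
          exact (hom_app_map i.hom _ m).trans (h u _)
        prop_of_epi := by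
          rintro M N p _ ⟨n, hn, h⟩
          refine ⟨n, hn, fun u m => ?_⟩
          obtain ⟨l, rfl⟩ := fp_surjective_of_epi p _ m
          rw [← hom_app_map, h, map_zero]
        prop_X₂_of_shortExact := by
          rintro S hS ⟨n, hn, h₁⟩ ⟨m, hm, h₃⟩
          obtain ⟨e, e', h⟩ := tensorPowMap_add f m n
          refine ⟨m + n, by omega, ?_⟩
          rw [h]
          exact (Kills.tensorHom_of_shortExact hS h₁ h₃).comp_comp e e' }
  · rintro v M ⟨n, hn, h⟩
    exact ⟨n, hn, h.twist v⟩

lemma kills_tensorPowMap_one {x y : K} {f : x ⟶ y} {M : ModCat K} (h : Kills f M) :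
    Kills (tensorPowMap f 1) M := by
  have e : tensorPowMap f 1 = (λ_ x).hom ≫ f ≫ (λ_ y).inv := by
    change 𝟙 (𝟙_ K) ⊗ₘ f = _
    simp
  rw [e]
  exact h.comp_comp _ _

lemma exists_pow_whiskerRight_eq_zero {x y : K} {f : x ⟶ y} {z : K}
    (h : nilIdeal f ((yoFP K).obj z)) : ∃ n : ℕ, 1 ≤ n ∧ tensorPowMap f n ▷ z = 0 := by
  obtain ⟨n, hn, h⟩ := h
  exact ⟨n, hn, whiskerRight_eq_zero_of_kills h⟩

/-- The morphism `x ⊗ (ᘁy ⊗ 𝟙) ⟶ 𝟙` adjoint to `f : x ⟶ y`. -/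
def adjunct {x y : K} (f : x ⟶ y) : x ⊗ ((ᘁy) ⊗ 𝟙_ K) ⟶ 𝟙_ K :=
  f ▷ ((ᘁy) ⊗ 𝟙_ K) ≫ (tensorLeftHomEquiv ((ᘁy) ⊗ 𝟙_ K) (ᘁy) y (𝟙_ K)).symm (𝟙 _)

/-- Each `t : y ⊗ u ⟶ 𝟙` is `y ⊗ t'` followed by the evaluation of `y`, so `(f ⊗ u) ≫ t` factors
through the adjunct of `f`. -/
lemma kills_cokernel_adjunct {x y : K} (f : x ⟶ y) :
    Kills f (cokernel ((yoFP K).map (adjunct f))).obj := by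
  intro u m
  obtain ⟨t, ht⟩ := surjective_cokernel_π _ m
  let t' : u ⟶ (ᘁy) ⊗ 𝟙_ K := tensorLeftHomEquiv u (ᘁy) y (𝟙_ K) t
  have e : t = y ◁ t' ≫ (tensorLeftHomEquiv ((ᘁy) ⊗ 𝟙_ K) (ᘁy) y (𝟙_ K)).symm (𝟙 _) := by
    rw [← tensorLeftHomEquiv_symm_naturality, Category.comp_id, Equiv.symm_apply_apply]
  have e' : f ▷ u ≫ t = x ◁ t' ≫ adjunct f := by
    rw [e, adjunct, ← whisker_exchange_assoc]
  rw [← fpHom_eq_zero_iff, ← map_fpHom, ht, ← Functor.map_comp_assoc, e', Functor.map_comp_assoc,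
    cokernel.condition, comp_zero]

/-- If a Serre `⊗`-ideal contains all modules on which `f` is `⊗`-nilpotent and `f` vanishes on a
dense morphism, then the ideal contains both the image and the cokernel of the adjunct
`x ⊗ ᘁy ⟶ 𝟙` of `f`, hence the unit. -/
lemma IsSerreTensorIdeal.eq_top_of_nilIdeal_le {B : ObjectProperty (FPMod K)}
    (hB : IsSerreTensorIdeal B) {x y x' : K} {f : x ⟶ y} (hf : nilIdeal f ≤ B) {a : x' ⟶ x}
    (ha : Dense B a) (haf : a ≫ f = 0) : B = ⊤ := by
  have := hB.isSerreClass
  have hφ : Dense B (adjunct f) := dense_of_cokernel_mem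
    (hf _ ⟨1, le_rfl, kills_tensorPowMap_one (kills_cokernel_adjunct f)⟩)
  have h := (ha.whiskerRight hB ((ᘁy) ⊗ 𝟙_ K)).comp hφ
  rw [adjunct, ← comp_whiskerRight_assoc, haf, MonoidalPreadditive.zero_whiskerRight,
    zero_comp] at h
  exact hB.eq_top (mem_yoFP_of_dense_zero h)

lemma HomologicalPrime.residueFunctor_map_ne_zero (H : HomologicalPrime K) {x y : K} {f : x ⟶ y}
    (hf : nilIdeal f ≤ H.carrier) : (residueFunctor H.carrier).map f ≠ 0 := by
  intro h
  have := H.isSerreTensorIdeal.isSerreClass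
  obtain ⟨x', a, ha, haf⟩ := exists_dense_comp_eq_zero h
  exact H.ne_top (H.isSerreTensorIdeal.eq_top_of_nilIdeal_le hf ha haf)

end Nilpotence

/-! ### The triangular spectrum -/

section TriangularSpectrum

variable {K : Type u} [Category.{v} K] [Preadditive K]
    [HasZeroObject K] [HasShift K ℤ] [∀ n : ℤ, (shiftFunctor K n).Additive] [Pretriangulated K]

/-- The target of a zero morphism is a direct summand of its cone. -/
lemma exists_retract_of_trW_zero {P : ObjectProperty K} {x y : K} (h : P.trW (0 : x ⟶ y)) :
    ∃ z, P z ∧ Nonempty (Retract y z) := by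
  obtain ⟨z, g, h, hT, hz⟩ := h
  obtain ⟨r, hr⟩ := Pretriangulated.Triangle.yoneda_exact₂ _ hT (𝟙 y) zero_comp
  exact ⟨z, hz, ⟨⟨g, r, hr.symm⟩⟩⟩

variable [MonoidalCategory K] [IsTensorTriangulated K]

/-- Since `x ⊗ -` is exact, `x⟦n⟧` is isomorphic to `x ⊗ 𝟙⟦n⟧`. -/
lemma exists_tensor_iso_shift (x : K) (n : ℤ) : ∃ t : K, Nonempty (x ⊗ t ≅ x⟦n⟧) := by
  obtain ⟨hx, -⟩ := IsTensorTriangulated.exact_tensorLeft x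
  exact ⟨(𝟙_ K)⟦n⟧, ⟨((tensorLeft x).commShiftIso n).app (𝟙_ K) ≪≫
    (shiftFunctor K n).mapIso (ρ_ x)⟩⟩

lemma IsThickTensorIdeal.prop_of_iso {P : ObjectProperty K} (hP : IsThickTensorIdeal P) {x y : K}
    (e : x ≅ y) (hx : P x) : P y :=
  hP.isStableUnderRetracts.of_retract ⟨e.inv, e.hom, e.inv_hom_id⟩ hx

lemma Spc.not_unit_mem (P : Spc K) : ¬ P.carrier (𝟙_ K) := fun h =>
  P.ne_top (eq_top_iff.2 fun x _ =>
    P.isThickTensorIdeal.prop_of_iso (λ_ x) (P.isThickTensorIdeal.tensor_mem _ x h))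

lemma IsThickTensorIdeal.trW_whiskerRight {P : ObjectProperty K} (hP : IsThickTensorIdeal P)
    {x y : K} {f : x ⟶ y} (hf : P.trW f) (v : K) : P.trW (f ▷ v) := by
  obtain ⟨_, _⟩ := IsTensorTriangulated.exact_tensorRight v
  obtain ⟨z, g, h, hT, hz⟩ := hf
  exact ⟨_, _, _, (tensorRight v).map_distinguished _ hT, hP.tensor_mem z v hz⟩

lemma supp_biprod (x y : K) : supp (x ⊞ y) = supp x ∪ supp y := by
  ext P
  have := P.isThickTensorIdeal.isTriangulated
  have := P.isThickTensorIdeal.isStableUnderRetracts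
  refine Iff.trans (not_congr ?_) not_and_or
  constructor
  · exact fun h => ⟨P.carrier.prop_of_retract ⟨biprod.inl, biprod.fst, by simp⟩ h,
      P.carrier.prop_of_retract ⟨biprod.inr, biprod.snd, by simp⟩ h⟩
  · exact fun h => P.carrier.ext_of_isTriangulatedClosed₂ _
      (Pretriangulated.binaryBiproductTriangle_distinguished x y) h.1 h.2

variable [SymmetricCategory K]

lemma IsThickTensorIdeal.trW_whiskerLeft {P : ObjectProperty K} (hP : IsThickTensorIdeal P)
    {x y : K} {f : x ⟶ y} (hf : P.trW f) (v : K) : P.trW (v ◁ f) := by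
  obtain ⟨_, _⟩ := IsTensorTriangulated.exact_tensorLeft v
  obtain ⟨z, g, h, hT, hz⟩ := hf
  exact ⟨_, _, _, (tensorLeft v).map_distinguished _ hT,
    hP.prop_of_iso (β_ z v) (hP.tensor_mem z v hz)⟩

lemma IsThickTensorIdeal.trW_tensorPowMap [IsTriangulated K] {P : ObjectProperty K}
    (hP : IsThickTensorIdeal P) {x y : K} {f : x ⟶ y} (hf : P.trW f) (n : ℕ) :
    P.trW (tensorPowMap f n) := by
  have := hP.isTriangulated
  induction n with
  | zero => exact P.trW.id_mem _
  | succ n ih =>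
    change P.trW (tensorPowMap f n ⊗ₘ f)
    rw [MonoidalCategory.tensorHom_def]
    exact P.trW.comp_mem _ _ (hP.trW_whiskerRight ih _) (hP.trW_whiskerLeft hf _)

lemma supp_tensor (x y : K) : supp (x ⊗ y) = supp x ∩ supp y := by
  ext P
  have hP := P.isThickTensorIdeal
  constructor
  · exact fun h => ⟨fun hx => h (hP.tensor_mem x y hx),
      fun hy => h (hP.prop_of_iso (β_ y x) (hP.tensor_mem y x hy))⟩
  · exact fun h h' => (P.prime x y h').elim h.1 h.2

/-- The supports form a basis of closed subsets. -/
lemma exists_subset_supp_of_notMem {W : Set (Spc K)} (hW : IsClosed W) {P : Spc K} (hP : P ∉ W) :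
    ∃ s : K, W ⊆ supp s ∧ P ∉ supp s := by
  have h : ∀ U : Set (Spc K), TopologicalSpace.GenerateOpen
      (Set.range fun x : K => (supp x)ᶜ) U → P ∈ U → ∃ s : K, Uᶜ ⊆ supp s ∧ P ∉ supp s := by
    intro U hU
    induction hU with
    | basic U hU =>
      obtain ⟨x, rfl⟩ := hU
      exact fun hP => ⟨x, by simp, hP⟩
    | univ => exact fun _ => ⟨0, by simp, fun h => h (by
        have := P.isThickTensorIdeal.isTriangulated
        obtain ⟨Z, hZ, hZ'⟩ := P.carrier.exists_prop_of_containsZero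
        exact P.isThickTensorIdeal.prop_of_iso (hZ.iso (isZero_zero K)) hZ')⟩
    | inter U V _ _ hU hV =>
      rintro ⟨hPU, hPV⟩
      obtain ⟨s, hs, hs'⟩ := hU hPU
      obtain ⟨t, ht, ht'⟩ := hV hPV
      refine ⟨s ⊞ t, ?_, ?_⟩
      · rw [supp_biprod, Set.compl_inter]
        exact Set.union_subset_union hs ht
      · rw [supp_biprod]
        exact fun h => h.elim hs' ht'
    | sUnion S _ hS =>
      rintro ⟨U, hU, hPU⟩
      obtain ⟨s, hs, hs'⟩ := hS U hU hPU
      exact ⟨s, (Set.compl_subset_compl.2 (Set.subset_sUnion_of_mem hU)).trans hs, hs'⟩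
  obtain ⟨s, hs, hs'⟩ := h Wᶜ hW.isOpen_compl hP
  exact ⟨s, by rwa [compl_compl] at hs, hs'⟩

variable [RigidCategory K]

/-- A thick `⊗`-ideal that contains the cone of `ξ : w ⟶ 𝟙` contains all objects on which `ξ` is
`⊗`-nilpotent. -/
lemma IsThickTensorIdeal.mem_of_nilIdeal [IsTriangulated K] {P : ObjectProperty K}
    (hP : IsThickTensorIdeal P) {w : K} {ξ : w ⟶ 𝟙_ K} (hξ : P.trW ξ) {t : K}
    (ht : nilIdeal ξ ((yoFP K).obj t)) : P t := by
  obtain ⟨n, -, h⟩ := exists_pow_whiskerRight_eq_zero ht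
  have hn := hP.trW_whiskerRight (hP.trW_tensorPowMap hξ n) t
  rw [h] at hn
  obtain ⟨z, hz, ⟨r⟩⟩ := exists_retract_of_trW_zero hn
  obtain ⟨e⟩ := tensorPow_unit_iso (C := K) n
  exact hP.prop_of_iso (whiskerRightIso e t ≪≫ λ_ t) (hP.isStableUnderRetracts.of_retract r hz)

/-- For each object `s` there is a Serre `⊗`-ideal containing `s` whose objects of `K` lie in every
prime that contains `s`. It is given by the modules on which the fibre of `𝟙 ⟶ ᘁs ⊗ s` is
`⊗`-nilpotent. -/
lemma exists_isSerreTensorIdeal_mem [IsTriangulated K] (s : K) :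
    ∃ B : ObjectProperty (FPMod K), IsSerreTensorIdeal B ∧ B ((yoFP K).obj s) ∧
      ∀ t, B ((yoFP K).obj t) → ∀ P : Spc K, P.carrier s → P.carrier t := by
  obtain ⟨w, ξ, δ, hT⟩ := Pretriangulated.distinguished_cocone_triangle₁ (coevalRight (𝟙_ K) s)
  have hB := isSerreTensorIdeal_nilIdeal ξ
  have := hB.isSerreClass
  refine ⟨nilIdeal ξ, hB, ?_, fun t ht P hs => ?_⟩
  · have hξ : ξ ≫ coevalRight (𝟙_ K) s = 0 := Pretriangulated.comp_distTriang_mor_zero₁₂ _ hT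
    have h0 : ξ ▷ (ᘁs) = 0 := by
      rw [← Category.comp_id (ξ ▷ (ᘁs)), ← coevalRight_evalRight, ← comp_whiskerRight_assoc, hξ,
        MonoidalPreadditive.zero_whiskerRight, zero_comp]
    have h : nilIdeal ξ ((yoFP K).obj (ᘁs)) :=
      ⟨1, le_rfl, kills_tensorPowMap_one (kills_yo_of_whiskerRight_eq_zero h0)⟩
    refine hB.mem_of_iso (λ_ s) (mem_yoFP_of_retract _ _
      (coevalRight_whiskerRight_evalRight (𝟙_ K) s) (hB.mem_tensor ?_ s))
    exact hB.mem_of_iso (β_ _ _) (hB.mem_tensor h (𝟙_ K ⊗ s))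
  · have hP := P.isThickTensorIdeal
    exact hP.mem_of_nilIdeal ⟨_, _, _, hT, hP.prop_of_iso (β_ _ _) (hP.tensor_mem _ _ hs)⟩ ht

/-- The triangular prime `h⁻¹(B)` below a homological prime `B`. -/
def HomologicalPrime.toSpc (H : HomologicalPrime K) : Spc K where
  carrier := H.carrier.inverseImage (yoFP K)
  isThickTensorIdeal := by
    have hH := H.isSerreTensorIdeal
    have := hH.isSerreClass
    have : (H.carrier.inverseImage (yoFP K)).IsTriangulatedClosed₂ :=
      .mk' fun T hT h₁ h₃ => mem_yoFP_of_exact (f := T.mor₁) (g := T.mor₂)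
        (fun w t ht => by
          obtain ⟨r, hr⟩ := T.coyoneda_exact₂ hT t ht
          exact ⟨r, hr.symm⟩) h₁ h₃
    refine ⟨{ exists_zero := ?_, isStableUnderShiftBy := ?_ }, ⟨?_⟩, ?_⟩
    · exact ⟨0, isZero_zero K, H.carrier.prop_of_isZero ((yoFP K).map_isZero (isZero_zero K))⟩
    · refine fun n => ⟨fun x hx => ?_⟩
      obtain ⟨t, ⟨e⟩⟩ := exists_tensor_iso_shift x n
      exact hH.mem_of_iso e (hH.mem_tensor hx t)
    · intro x y r hy
      exact mem_yoFP_of_retract r.i r.r r.retract hy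
    · exact fun x y hx => hH.mem_tensor hx y
  ne_top h := H.ne_top (H.isSerreTensorIdeal.eq_top (by
    have : (H.carrier.inverseImage (yoFP K)) (𝟙_ K) := by rw [h]; trivial
    exact this))
  prime _ _ := H.prime

/-- If no finite part of a cover of the complement of `supp s` suffices, then the objects `t` whose
`(supp t)ᶜ` is finitely covered form a `⊗`-multiplicative class, and a homological prime that
contains `s` and avoids this class yields a point that is not covered. -/
lemma isCompact_compl_supp [IsTriangulated K] (s : K) : IsCompact (supp s)ᶜ := by
  refine isCompact_generateFrom rfl fun F hF hcover => ?_
  obtain ⟨B, hB, hs, hBs⟩ := exists_isSerreTensorIdeal_mem s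
  by_contra! hfin
  obtain ⟨H, hBH, hH⟩ := exists_homologicalPrime hB
    (fun t => ∃ Q ⊆ F, Q.Finite ∧ (supp t)ᶜ ⊆ ⋃₀ Q)
    ⟨∅, by simp, Set.finite_empty, fun P hP => (hP P.not_unit_mem).elim⟩
    (by
      rintro t t' ⟨Q, hQ, hQf, h⟩ ⟨Q', hQ', hQf', h'⟩
      refine ⟨Q ∪ Q', Set.union_subset hQ hQ', hQf.union hQf', fun P hP => ?_⟩
      rw [Set.sUnion_union]
      rcases P.prime t t' (not_not.1 hP) with ht | ht
      · exact Or.inl (h (not_not.2 ht))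
      · exact Or.inr (h' (not_not.2 ht)))
    (by
      rintro t ⟨Q, hQ, hQf, h⟩ ht
      exact hfin Q hQ hQf fun P hP => h (not_not.2 (hBs t ht P (not_not.1 hP))))
  obtain ⟨U, hU, hPU⟩ := hcover (show H.toSpc ∈ (supp s)ᶜ from not_not.2 (hBH _ hs))
  obtain ⟨t, rfl⟩ := hF hU
  exact hH t ⟨{(supp t)ᶜ}, by simpa using hU, Set.finite_singleton _, by simp⟩ (not_not.1 hPU)

/-- An object whose support is contained in that of `s` lies in every Serre `⊗`-ideal that
contains `s`. -/
lemma IsSerreTensorIdeal.mem_of_supp_subset {B : ObjectProperty (FPMod K)}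
    (hB : IsSerreTensorIdeal B) {s z : K} (hs : B ((yoFP K).obj s)) (hz : supp z ⊆ supp s) :
    B ((yoFP K).obj z) := by
  by_contra h
  -- The objects `t` below form a `⊗`-multiplicative class that contains `z` and all its powers.
  obtain ⟨H, hBH, hH⟩ := exists_homologicalPrime hB
    (fun t => ∀ C : ObjectProperty (FPMod K), IsSerreTensorIdeal C → C ((yoFP K).obj t) →
      C ((yoFP K).obj z))
    (fun C hC h => hC.mem_of_iso (λ_ z) (hC.mem_tensor h z))
    (fun t t' ht ht' C hC h => by
      have := hC.isSerreClass
      have h₁ : C ((yoFP K).obj (z ⊗ t')) :=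
        (colon_yoFP_iff z t').1 (ht _ (hC.colon t') ((colon_yoFP_iff t t').2 h))
      have h₂ : C ((yoFP K).obj (z ⊗ z)) := (colon_yoFP_iff z z).1
        (ht' _ (hC.colon z) ((colon_yoFP_iff t' z).2 (hC.mem_of_iso (β_ z t') h₁)))
      exact hC.mem_of_mem_tensor_self h₂)
    (fun t ht hBt => h (ht B hB hBt))
  exact hz (show H.toSpc ∈ supp z from hH z fun _ _ h => h) (hBH _ hs)

end TriangularSpectrum

end
end TTGeom

theorem corollary4p4 {K : Type u} [Category.{v} K] [EssentiallySmall.{v} K] [Preadditive K]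
    [HasZeroObject K] [HasShift K ℤ] [∀ n : ℤ, (shiftFunctor K n).Additive] [Pretriangulated K]
    [IsTriangulated K] [MonoidalCategory K] [SymmetricCategory K] [RigidCategory K]
    [TTGeom.IsTensorTriangulated K] {x y : K} (f : x ⟶ y) (W : Set (TTGeom.Spc K))
    (hW : IsClosed W)
    (hf : ∀ B : TTGeom.HomologicalPrime K, B.LivesOver W →
      (TTGeom.residueFunctor B.carrier).map f = 0) :
    ∃ Z : Set (TTGeom.Spc K), TTGeom.IsThomasonClosed Z ∧ W ⊆ Z ∧
      (∀ z : K, TTGeom.supp z ⊆ Z → ∃ n : ℕ, 1 ≤ n ∧ TTGeom.tensorPowMap f n ▷ z = 0) ∧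
      ∃ z : K, TTGeom.supp z = Z ∧ ∃ n : ℕ, 1 ≤ n ∧ TTGeom.tensorPowMap f n ▷ z = 0 := by
  have hI := TTGeom.isSerreTensorIdeal_nilIdeal f
  obtain ⟨s, hWs, hs⟩ : ∃ s : K, W ⊆ TTGeom.supp s ∧ TTGeom.nilIdeal f ((TTGeom.yoFP K).obj s) := by
    by_contra! h
    obtain ⟨H, hfH, hH⟩ := TTGeom.exists_homologicalPrime hI (fun s => W ⊆ TTGeom.supp s)
      (fun P _ => P.not_unit_mem)
      (fun s t hs ht => by rw [TTGeom.supp_tensor]; exact Set.subset_inter hs ht) h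
    refine H.residueFunctor_map_ne_zero hfH (hf H ⟨H.toSpc, ?_, rfl⟩)
    by_contra hHW
    obtain ⟨s, hs, hs'⟩ := TTGeom.exists_subset_supp_of_notMem hW hHW
    exact hs' (hH s hs)
  have hnil : ∀ z : K, TTGeom.supp z ⊆ TTGeom.supp s →
      ∃ n : ℕ, 1 ≤ n ∧ TTGeom.tensorPowMap f n ▷ z = 0 := fun z hz =>
    TTGeom.exists_pow_whiskerRight_eq_zero (hI.mem_of_supp_subset hs hz)
  refine ⟨TTGeom.supp s, ⟨?_, TTGeom.isCompact_compl_supp s⟩, hWs, hnil, s, rfl, hnil s subset_rfl⟩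
  exact ⟨TopologicalSpace.GenerateOpen.basic _ ⟨s, rfl⟩⟩
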